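/- **Proposition.** Let $X$ be a Riemann surface and let $\Sigma\subseteq X$ be open (e.g. $\Sigma=X$). For charts $z_c,z_{c'}$ put $k_{cc'}=dz_c/dz_{c'}$, and let $K$ be the canonical bundle. Let $\mathfrak g$ be a finite-dimensional complex simple Lie algebra, $\mathfrak h$ a Cartan subalgebra with simple roots $\alpha_1,\dots,\alpha_r$, let $\rho$ be the conjugation of $\mathfrak g$ with respect to a compact real form, and let $e_\alpha$ be root vectors with $\rho(e_\alpha)=-e_{-\alpha}$. Put $h_\alpha=[e_\alpha,e_{-\alpha}]$, $h_i=h_{\alpha_i}$, $\mathcal E_+=\sum_i e_{\alpha_i}$, and let $x\in\mathfrak h$ satisfy $\alpha_i(x)=1$ for all $i$. Let $\psi$ be the highest (longest) root and $k$ its height, i.e. $\psi(x)=k$ (so $k=\operatorname{rank}\mathfrak g$ for $\mathfrak g=A_{n-1}$). Let $\pi:\mathfrak g\to\operatorname{End}(V)$ be a finite-dimensional representation on a Hermitian space with $\pi(\rho(X))=-\pi(X)^*$ for all $X\in\mathfrak g$, and let $E$ be the bundle $\bigoplus_a V_a\otimes K^{-a}$ on $\Sigma$, where $V_a$ is the eigenspace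 of $\pi(x)$ with eigenvalue $a$, that is, the bundle with transition functions $k_{cc'}^{\pi(x)}$; these are defined through a holomorphic square root of the cocycle $k_{cc'}$ (a choice of $K^{1/2}$), or directly, without any choice, if all eigenvalues of $\pi(x)$ are integers. (For $\mathfrak g=\mathfrak{sl}_n$ and $V=\mathbb C^n$ this is $\bigoplus_{r=0}^{n-1}K^{-\frac{n-1}2+r}$; for the adjoint representation it is a bundle with fibre $\mathfrak g$.) A Toda field on $\Sigma$ is given in each chart by a smooth function $\Phi$ with values in $\bigoplus_i\mathbb R h_i$ such that each $e^{\alpha_i(\Phi)}|dz|^2$ is independent of the chart. 1. Let $\Phi$ be a Toda field that solves the standard Toda equations $$\partial_z\partial_{\bar z}\Phi=\sum_i h_i\,e^{\alpha_i(\Phi)} .$$ Then $E$ is a well-defined holomorphic vector bundle, $H=e^{\pi(\Phi)}$ is a Hermitian metric on it, $\theta=\pi(\mathcal E_+)\,dz$ is a holomorphic section of $\operatorname{End}E\otimes K$, and Hitchin's equation $F_H+[\theta,\theta^*]=0$ holds, where $F_H$ is the curvature of the Chern connection of $H$ and $\theta^*$ is the adjoint of $\theta$ with respect to $H$. 2.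 Let $\Phi$ be a Toda field and $u$ a smooth section of $K^{k+1}$ that solve $$\partial_z\partial_{\bar z}\Phi=\sum_i h_i\,e^{\alpha_i(\Phi)}-|u|^2e^{-\psi(\Phi)}h_\psi,\qquad \bar\partial u=0 .$$ Then all conclusions of 1 hold with $\theta=\pi(\mathcal E_++u\,e_{-\psi})\,dz$ in place of $\pi(\mathcal E_+)\,dz$. 3. Let $\Phi$ be a Toda field and $\eta$ a smooth real field, given in each chart and such that $e^{2\eta}|dz|^{2(k+1)}$ is independent of the chart, that solve the Conformal Affine Toda equations $$\partial_z\partial_{\bar z}\Phi=\sum_i h_i\,e^{\alpha_i(\Phi)}-e^{2\eta-\psi(\Phi)}h_\psi,\qquad \partial_z\partial_{\bar z}\eta=0 .$$ Then for every open $W\subseteq\Sigma$ and every holomorphic section $u$ of $K^{k+1}$ over $W$ with $|u|^2=e^{2\eta}$ in each chart, the conclusions of 2 hold over $W$ for $\theta=\pi(\mathcal E_++u\,e_{-\psi})\,dz$; and every point of $\Sigma$ has an open neighbourhood $W$ on which such a section $u$ exists. -/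

import Mathlib

open scoped ContDiff Manifold InnerProductSpace

namespace TodaHiggs

/-! ### Wirtinger derivatives in a coordinate `z` -/

section Wirtinger

variable {F : Type*} [NormedAddCommGroup F] [NormedSpace ℂ F]

/-- `∂f/∂z = (∂f/∂x - i ∂f/∂y) / 2`. -/
noncomputable def dz (f : ℂ → F) (z : ℂ) : F :=
  (1 / 2 : ℂ) • (fderiv ℝ f z 1 - Complex.I • fderiv ℝ f z Complex.I)

/-- `∂f/∂z̄ = (∂f/∂x + i ∂f/∂y) / 2`. -/
noncomputable def dzbar (f : ℂ → F) (z : ℂ) : F :=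
  (1 / 2 : ℂ) • (fderiv ℝ f z 1 + Complex.I • fderiv ℝ f z Complex.I)

end Wirtinger

/-! ### Holomorphic bundles, metrics and Higgs fields over an open subset of a Riemann surface

A local object is given by its representative in every chart `c` of the atlas, a function on `X` of
which only the values on `c.source ∩ U` matter. -/

section Surface

variable {X : Type*} [TopologicalSpace X] [ChartedSpace ℂ X]

/-- The open set of the coordinate plane that corresponds to `c.source ∩ U` in the chart `c`. -/
def coordDomain (U : Set X) (c : atlas ℂ X) : Set ℂ :=
  c.1.target ∩ c.1.symm ⁻¹' U

/-- The derivative `k_{cc'} = dz_c / dz_{c'}` of the change of coordinates. -/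
noncomputable def jac (c c' : atlas ℂ X) (p : X) : ℂ :=
  deriv (fun z => c.1 (c'.1.symm z)) (c'.1 p)

/-- An `N`-th root of the canonical bundle `K`, given by a holomorphic cocycle `κ` over `U` with
`κ_{cc'} ^ N = k_{cc'}`. For `N = 1` this is `κ = k`, for `N = 2` it is a spin structure. -/
structure IsCanonicalRoot (U : Set X) (N : ℕ) (κ : atlas ℂ X → atlas ℂ X → X → ℂ) : Prop where
  holomorphic : ∀ c c', DifferentiableOn ℂ (fun z => κ c c' (c'.1.symm z))
    (coordDomain (U ∩ c.1.source) c')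
  pow_eq : ∀ c c', ∀ p ∈ U ∩ c.1.source ∩ c'.1.source, κ c c' p ^ N = jac c c' p
  cocycle : ∀ c c' c'', ∀ p ∈ U ∩ c.1.source ∩ c'.1.source ∩ c''.1.source,
    κ c c' p * κ c' c'' p = κ c c'' p

/-- A `C^∞` section over `U` of `K^m`: functions `u_c` with `u_c (dz_c)^m = u_{c'} (dz_{c'})^m`. -/
structure IsSmoothSection (U : Set X) (m : ℤ) (u : atlas ℂ X → X → ℂ) : Prop where
  smooth : ∀ c, ContDiffOn ℝ ∞ (fun z => u c (c.1.symm z)) (coordDomain U c)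
  transform : ∀ c c', ∀ p ∈ U ∩ c.1.source ∩ c'.1.source, jac c c' p ^ m * u c p = u c' p

/-- The equation `∂̄u = 0` over `U`. -/
def DbarClosed (U : Set X) (u : atlas ℂ X → X → ℂ) : Prop :=
  ∀ c, ∀ p ∈ U ∩ c.1.source, dzbar (fun z => u c (c.1.symm z)) (c.1 p) = 0

variable {V : Type*} [NormedAddCommGroup V] [InnerProductSpace ℂ V] [CompleteSpace V]

/-- `g` is the cocycle of a holomorphic vector bundle over `U` with fibre `V`; a section is a family
`s_c` with `s_c = g_{cc'} s_{c'}`. -/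
structure IsHolomorphicBundle (U : Set X) (g : atlas ℂ X → atlas ℂ X → X → V →L[ℂ] V) : Prop where
  holomorphic : ∀ c c', DifferentiableOn ℂ (fun z => g c c' (c'.1.symm z))
    (coordDomain (U ∩ c.1.source) c')
  one : ∀ c, ∀ p ∈ U ∩ c.1.source, g c c p = 1
  cocycle : ∀ c c' c'', ∀ p ∈ U ∩ c.1.source ∩ c'.1.source ∩ c''.1.source,
    g c c' p * g c' c'' p = g c c'' p

/-- A `C^∞` Hermitian fibre metric over `U` on the bundle with cocycle `g`. In the chart `c` the
metric is `(v, w) ↦ ⟪v, H_c w⟫`. -/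
structure IsHermitianMetric (U : Set X) (g : atlas ℂ X → atlas ℂ X → X → V →L[ℂ] V)
    (H : atlas ℂ X → X → V →L[ℂ] V) : Prop where
  smooth : ∀ c, ContDiffOn ℝ ∞ (fun z => H c (c.1.symm z)) (coordDomain U c)
  hermitian : ∀ c, ∀ p ∈ U ∩ c.1.source, ∀ v w : V, ⟪v, H c p w⟫_ℂ = ⟪H c p v, w⟫_ℂ
  positive : ∀ c, ∀ p ∈ U ∩ c.1.source, ∀ v : V, v ≠ 0 → 0 < (⟪v, H c p v⟫_ℂ).re
  transform : ∀ c c', ∀ p ∈ U ∩ c.1.source ∩ c'.1.source, ∀ v w : V,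
    ⟪v, H c' p w⟫_ℂ = ⟪g c c' p v, H c p (g c c' p w)⟫_ℂ

/-- A Higgs field over `U`: a holomorphic section `θ = θ_c dz_c` of `End E ⊗ K`. -/
structure IsHiggsField (U : Set X) (g : atlas ℂ X → atlas ℂ X → X → V →L[ℂ] V)
    (θ : atlas ℂ X → X → V →L[ℂ] V) : Prop where
  holomorphic : ∀ c, DifferentiableOn ℂ (fun z => θ c (c.1.symm z)) (coordDomain U c)
  transform : ∀ c c', ∀ p ∈ U ∩ c.1.source ∩ c'.1.source,
    jac c c' p • (θ c p * g c c' p) = g c c' p * θ c' p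

/-- The `(1,0)`-part `h⁻¹ ∂h` of the connection form of the metric (Chern) connection of the
metric `⟪v, h w⟫` in a holomorphic frame; its `(0,1)`-part is `0`. -/
noncomputable def chernForm (h : ℂ → V →L[ℂ] V) (z : ℂ) : V →L[ℂ] V :=
  Ring.inverse (h z) * dz h z

/-- The coefficient of `dz ∧ dz̄` in the curvature of the connection `d + A dz + B dz̄`. -/
noncomputable def curvature (A B : ℂ → V →L[ℂ] V) (z : ℂ) : V →L[ℂ] V :=
  dz B z - dzbar A z + (A z * B z - B z * A z)

/-- The adjoint of the endomorphism `T` with respect to the metric `⟪v, h w⟫`. -/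
noncomputable def metricAdjoint (h T : V →L[ℂ] V) : V →L[ℂ] V :=
  Ring.inverse h * ContinuousLinearMap.adjoint T * h

/-- `F_H + [θ, θ^*] = 0` over `U`, where `F_H` is the curvature of the Chern connection of `H`;
written with `θ = θ_c dz_c` and `[θ, θ^*] = θ ∧ θ^* + θ^* ∧ θ`. -/
def HitchinEquation (U : Set X) (H θ : atlas ℂ X → X → V →L[ℂ] V) : Prop :=
  ∀ c, ∀ p ∈ U ∩ c.1.source,
    curvature (chernForm (fun z => H c (c.1.symm z))) 0 (c.1 p)
      + (θ c p * metricAdjoint (H c p) (θ c p) - metricAdjoint (H c p) (θ c p) * θ c p) = 0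

/-- `g` is a holomorphic vector bundle over `U` with Higgs field `θ` and Hermitian metric `H`,
and they solve Hitchin's equation. -/
structure IsHitchinSolution (U : Set X) (g : atlas ℂ X → atlas ℂ X → X → V →L[ℂ] V)
    (H θ : atlas ℂ X → X → V →L[ℂ] V) : Prop where
  bundle : IsHolomorphicBundle U g
  metric : IsHermitianMetric U g H
  higgs : IsHiggsField U g θ
  equation : HitchinEquation U H θ

end Surface

/-! ### Lie algebra data -/

section LieData

variable {𝔤 : Type*} [LieRing 𝔤] [LieAlgebra ℂ 𝔤] [FiniteDimensional ℂ 𝔤]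

/-- The conjugation of `𝔤` whose fixed points are a compact real form. -/
structure CompactConjugation (𝔤 : Type*) [LieRing 𝔤] [LieAlgebra ℂ 𝔤] where
  conj : 𝔤 →ₛₗ[starRingEnd ℂ] 𝔤
  map_lie : ∀ x y, conj ⁅x, y⁆ = ⁅conj x, conj y⁆
  involutive : ∀ x, conj (conj x) = x
  compact : ∀ x, x ≠ 0 → (killingForm ℂ 𝔤 x (conj x)).re < 0

/-- A unitary representation, `π (ρ x) = - (π x)^*`. -/
structure UnitaryRep (ρ : CompactConjugation 𝔤)
    (V : Type*) [NormedAddCommGroup V] [InnerProductSpace ℂ V] where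
  map : 𝔤 →ₗ[ℂ] (V →L[ℂ] V)
  map_lie : ∀ x y, map ⁅x, y⁆ = map x * map y - map y * map x
  unitary : ∀ x v w, ⟪v, map (ρ.conj x) w⟫_ℂ = -⟪map x v, w⟫_ℂ

variable [LieAlgebra.IsKilling ℂ 𝔤] (𝔥 : LieSubalgebra ℂ 𝔤) [𝔥.IsCartanSubalgebra]

/-- A Weyl basis: root vectors `e_α` such that the compact conjugation maps `e_α` to `-e_{-α}`.
(The value at the zero weight is irrelevant.) -/
structure WeylBasis (ρ : CompactConjugation 𝔤) where
  e : LieModule.Weight ℂ 𝔥 𝔤 → 𝔤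
  mem : ∀ α : LieModule.Weight ℂ 𝔥 𝔤, e α ∈ LieAlgebra.rootSpace 𝔥 α
  ne_zero : ∀ α, α.IsNonZero → e α ≠ 0
  conj_e : ∀ α, α.IsNonZero → ρ.conj (e α) = -e (-α)

variable {𝔥} {ρ : CompactConjugation 𝔤}

theorem WeylBasis.lie_mem (D : WeylBasis 𝔥 ρ) (α : LieModule.Weight ℂ 𝔥 𝔤) :
    ⁅D.e α, D.e (-α)⁆ ∈ 𝔥 := by
  have h := LieAlgebra.lie_mem_genWeightSpace_of_mem_genWeightSpace (D.mem α) (D.mem (-α))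
  have h0 : (⇑α + ⇑(-α) : 𝔥 → ℂ) = 0 := by
    rw [LieModule.Weight.coe_neg, add_neg_cancel]
  have hz := LieAlgebra.rootSpace_zero_eq ℂ 𝔤 𝔥
  have h' : ⁅D.e α, D.e (-α)⁆ ∈ LieAlgebra.rootSpace 𝔥 (0 : 𝔥 → ℂ) := h0 ▸ h
  rw [hz] at h'
  simpa using h'

/-- `h_α = [e_α, e_{-α}]`. -/
noncomputable def WeylBasis.h (D : WeylBasis 𝔥 ρ) (α : LieModule.Weight ℂ 𝔥 𝔤) : 𝔥 :=
  ⟨⁅D.e α, D.e (-α)⁆, D.lie_mem α⟩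

variable (b : (LieAlgebra.IsKilling.rootSystem 𝔥).Base)

/-- `E_+`, the sum of the simple root vectors. -/
noncomputable def WeylBasis.ePlus (D : WeylBasis 𝔥 ρ) : 𝔤 := ∑ i ∈ b.support, D.e i.1

/-- The element `x ∈ 𝔥` with `α(x) = 1` for every simple root `α`. -/
noncomputable def gradingElement : 𝔥 :=
  (Module.evalEquiv ℂ 𝔥).symm (∑ i, b.toWeightBasis.coord i)

theorem root_gradingElement (i : 𝔥.root) (hi : i ∈ b.support) :
    i.1 (gradingElement b) = 1 := by
  classical
  have h1 : (LieAlgebra.IsKilling.rootSystem 𝔥).root i (gradingElement b)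
      = (∑ j, b.toWeightBasis.coord j) ((LieAlgebra.IsKilling.rootSystem 𝔥).root i) := by
    rw [gradingElement, Module.apply_evalEquiv_symm_apply]
  have h2 := b.toWeightBasis_repr_root ⟨i, hi⟩
  have h3 : (∑ j, b.toWeightBasis.coord j) ((LieAlgebra.IsKilling.rootSystem 𝔥).root i) = 1 := by
    simp only [LinearMap.sum_apply, Module.Basis.coord_apply, h2]
    simp [Finsupp.single_apply]
  rw [h3] at h1
  simpa using h1

/-- `ψ` is the highest (longest) root: `ψ - α` is a sum of simple roots, for every root `α`. -/
def IsHighestRoot (ψ : 𝔥.root) : Prop :=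
  ∀ α : 𝔥.root, (LieAlgebra.IsKilling.rootSystem 𝔥).root ψ - (LieAlgebra.IsKilling.rootSystem 𝔥).root α
    ∈ AddSubmonoid.closure ((LieAlgebra.IsKilling.rootSystem 𝔥).root '' b.support)

end LieData

/-! ### Toda fields -/

section Toda

variable {X : Type*} [TopologicalSpace X] [ChartedSpace ℂ X]
  {𝔤 : Type*} [LieRing 𝔤] [LieAlgebra ℂ 𝔤] [FiniteDimensional ℂ 𝔤] [LieAlgebra.IsKilling ℂ 𝔤]
  {𝔥 : LieSubalgebra ℂ 𝔤} [𝔥.IsCartanSubalgebra]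
  {ρ : CompactConjugation 𝔤} (D : WeylBasis 𝔥 ρ) (b : (LieAlgebra.IsKilling.rootSystem 𝔥).Base)

/-- The field `Φ_c = ∑ φ_{c,i} h_i` with values in the real span of the basis `h_i` of `𝔥`. -/
noncomputable def cartanField (φ : atlas ℂ X → b.support → X → ℝ) (c : atlas ℂ X) (p : X) : 𝔥 :=
  ∑ i, (φ c i p : ℂ) • D.h i.1.1

/-- The Laplacian `∂_z ∂_{z̄} f` in the chart `c`, of a real function `f`. -/
noncomputable def ddbar (f : X → ℝ) (c : atlas ℂ X) (p : X) : ℂ :=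
  dz (dzbar (fun z => (f (c.1.symm z) : ℂ))) (c.1 p)

/-- `∂_z ∂_{z̄} Φ = ∑ (∂_z ∂_{z̄} φ_i) h_i` in the chart `c`. -/
noncomputable def ddbarField (φ : atlas ℂ X → b.support → X → ℝ) (c : atlas ℂ X) (p : X) : 𝔥 :=
  ∑ i, ddbar (φ c i) c p • D.h i.1.1

/-- A smooth field over `U` with values in the (real) Cartan subalgebra and the conformal
transformation law of Toda fields: `e^{α(Φ_c)} |dz_c|^2` does not depend on the chart `c`, for every
simple root `α`. -/
structure IsTodaField (U : Set X) (φ : atlas ℂ X → b.support → X → ℝ) : Prop where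
  smooth : ∀ c i, ContDiffOn ℝ ∞ (fun z => φ c i (c.1.symm z)) (coordDomain U c)
  transform : ∀ c c', ∀ p ∈ U ∩ c.1.source ∩ c'.1.source, ∀ i ∈ b.support,
    Complex.exp (i.1 (cartanField D b φ c' p))
      = (‖jac c c' p‖ : ℂ) ^ 2 * Complex.exp (i.1 (cartanField D b φ c p))

/-- `∂∂̄Φ = ∑ h_i e^{α_i(Φ)}` over `U`. -/
def TodaEquation (U : Set X) (φ : atlas ℂ X → b.support → X → ℝ) : Prop :=
  ∀ c, ∀ p ∈ U ∩ c.1.source, ddbarField D b φ c p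
    = ∑ i ∈ b.support, Complex.exp (i.1 (cartanField D b φ c p)) • D.h i.1

/-- `∂∂̄Φ = ∑ h_i e^{α_i(Φ)} - |u|^2 e^{-ψ(Φ)} h_ψ` and `∂̄u = 0` over `U`. -/
def AffineTodaEquation (U : Set X) (ψ : 𝔥.root) (φ : atlas ℂ X → b.support → X → ℝ)
    (u : atlas ℂ X → X → ℂ) : Prop :=
  (∀ c, ∀ p ∈ U ∩ c.1.source, ddbarField D b φ c p
    = ∑ i ∈ b.support, Complex.exp (i.1 (cartanField D b φ c p)) • D.h i.1
      - ((‖u c p‖ : ℂ) ^ 2 * Complex.exp (-ψ.1 (cartanField D b φ c p))) • D.h ψ.1)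
  ∧ DbarClosed U u

/-- A smooth real field `η` over `U` that transforms such that `e^{2η}` is a Hermitian square of a
section of `K^m`: `e^{2η_c} |dz_c|^{2m}` does not depend on the chart `c`. -/
structure IsAffineField (U : Set X) (m : ℤ) (η : atlas ℂ X → X → ℝ) : Prop where
  smooth : ∀ c, ContDiffOn ℝ ∞ (fun z => η c (c.1.symm z)) (coordDomain U c)
  transform : ∀ c c', ∀ p ∈ U ∩ c.1.source ∩ c'.1.source,
    Real.exp (2 * η c' p) = ‖jac c c' p‖ ^ (2 * m) * Real.exp (2 * η c p)

/-- `∂∂̄Φ = ∑ h_i e^{α_i(Φ)} - e^{2η - ψ(Φ)} h_ψ` and `∂∂̄η = 0` over `U`. -/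
def ConformalAffineTodaEquation (U : Set X) (ψ : 𝔥.root) (φ : atlas ℂ X → b.support → X → ℝ)
    (η : atlas ℂ X → X → ℝ) : Prop :=
  (∀ c, ∀ p ∈ U ∩ c.1.source, ddbarField D b φ c p
    = ∑ i ∈ b.support, Complex.exp (i.1 (cartanField D b φ c p)) • D.h i.1
      - Complex.exp (2 * (η c p : ℂ) - ψ.1 (cartanField D b φ c p)) • D.h ψ.1)
  ∧ ∀ c, ∀ p ∈ U ∩ c.1.source, ddbar (η c) c p = 0

variable {V : Type*} [NormedAddCommGroup V] [InnerProductSpace ℂ V] (π : UnitaryRep ρ V)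

/-- The transition functions `k_{cc'}^{π(x)}`, with `x` the grading element and `k = κ ^ N`: on the
eigenspace of `π(x)` with eigenvalue `a`, the factor is `κ_{cc'}^{N a}`. The bundle is
`⨁ V_a ⊗ K^{-a}`. -/
noncomputable def todaBundle (N : ℕ) (κ : atlas ℂ X → atlas ℂ X → X → ℂ) (c c' : atlas ℂ X) (p : X) :
    V →L[ℂ] V :=
  NormedSpace.exp (((N : ℂ) * Complex.log (κ c c' p)) • π.map (gradingElement b : 𝔤))

/-- The metric `H = e^Φ`. -/
noncomputable def todaMetric (φ : atlas ℂ X → b.support → X → ℝ) (c : atlas ℂ X) (p : X) :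
    V →L[ℂ] V :=
  NormedSpace.exp (π.map (cartanField D b φ c p : 𝔤))

/-- The Higgs field `θ = (E_+ + u e_{-ψ}) dz`. -/
noncomputable def affineHiggs (ψ : 𝔥.root) (u : atlas ℂ X → X → ℂ) (c : atlas ℂ X) (p : X) :
    V →L[ℂ] V :=
  π.map (D.ePlus b + u c p • D.e (-ψ.1))

/-- The Higgs field `θ = E_+ dz`. -/
noncomputable def todaHiggs (_c : atlas ℂ X) (_p : X) : V →L[ℂ] V :=
  π.map (D.ePlus b)

end Toda

end TodaHiggs

/-!
Everything is computed in the local frames, where `E` has fibre `V`, the metric is `H = e^{π(Φ)}`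
and `θ = π(y)` for a `𝔤`-valued function `y`.

*Hitchin's equation.* The values of `Φ` commute, so `H⁻¹ ∂H = π(∂Φ)` and the curvature of the Chern
connection is `-π(∂∂̄Φ)` (`curvature_chernForm_exp_sum`). Since `π(e_α)^* = π(e_{-α})` and
`[Φ, e_α] = α(Φ) e_α`, the adjoint of `π(e_α)` with respect to `H` is `e^{α(Φ)} π(e_{-α})`
(`metricAdjoint_todaMetric_e`). Hence `[θ, θ^*]` is `π` of a bracket in `𝔤`
(`hitchinEquation_of_lie`). In it only the terms `[e_i, e_{-i}] = h_i` and `[e_{-ψ}, e_ψ] = -h_ψ`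
survive, as neither a difference of distinct simple roots nor `ψ + α_i` is a root or zero; so the
equation is the Toda equation.

*Gluing.* As the simple roots separate the points of `𝔥`, the transformation law of a Toda field
says `Φ_{c'} = Φ_c + 2 log |k_{cc'}| x` (`cartanField_transform`), which is the transformation law of
a metric under `g = k^{π(x)}`, because `π(x)` is self-adjoint. Conjugation with `g` multiplies a root
vector of height `n` by `k^n` (`todaBundle_mul_e`): `E_+ dz` and `u e_{-ψ} dz` with `u` in `K^{k+1}`
are therefore sections of `End E ⊗ K`.

*The bundle.* `g` is holomorphic and a cocycle because `π(x)` is diagonalizable and `N` times its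
eigenvalues are integers (`exists_basis_todaBundle`). For `N = 2` the integrality is a fact about
`sl₂`: writing `2x = ∑ c_i h_i`, the elements `2x`, `E_+`, `∑ c_i e_{-i}` form an `sl₂`-triple
(`UnitaryRep.exists_int_eigenvalue`).

*The conformal affine equations.* `η` is harmonic, hence locally the real part of a holomorphic `F`,
and `u = e^F`, carried to the other charts by powers of `k`, is a holomorphic section of norm `e^η`
(`exists_section_norm_sq_eq`).
-/

namespace TodaHiggs

/-! ### Root vectors and the Cartan subalgebra -/

section LieTheory

variable {𝔤 : Type*} [LieRing 𝔤] [LieAlgebra ℂ 𝔤] [FiniteDimensional ℂ 𝔤]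
  [LieAlgebra.IsKilling ℂ 𝔤] {𝔥 : LieSubalgebra ℂ 𝔤} [𝔥.IsCartanSubalgebra]
  {ρ : CompactConjugation 𝔤}

theorem WeylBasis.lie_e (D : WeylBasis 𝔥 ρ) (α : LieModule.Weight ℂ 𝔥 𝔤) (y : 𝔥) :
    ⁅(y : 𝔤), D.e α⁆ = α y • D.e α :=
  LieAlgebra.IsKilling.lie_eq_smul_of_mem_rootSpace (D.mem α) y

theorem WeylBasis.coe_h (D : WeylBasis 𝔥 ρ) (α : LieModule.Weight ℂ 𝔥 𝔤) :
    (D.h α : 𝔤) = ⁅D.e α, D.e (-α)⁆ := rfl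

theorem WeylBasis.h_eq (D : WeylBasis 𝔥 ρ) (α : LieModule.Weight ℂ 𝔥 𝔤) :
    D.h α = killingForm ℂ 𝔤 (D.e α) (D.e (-α)) •
      (LieAlgebra.IsKilling.cartanEquivDual 𝔥).symm α.toLinear := by
  apply Subtype.ext
  have := LieAlgebra.IsKilling.lie_eq_killingForm_smul_of_mem_rootSpace_of_mem_rootSpace_neg
    (D.mem α) (f := D.e (-α)) (D.mem (-α))
  simpa [WeylBasis.coe_h] using this

/-- Compactness of the real form makes `e_α` and `e_{-α} = -ρ(e_α)` non-orthogonal. -/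
theorem WeylBasis.killingForm_e_ne_zero (D : WeylBasis 𝔥 ρ) {α : LieModule.Weight ℂ 𝔥 𝔤}
    (hα : α.IsNonZero) : killingForm ℂ 𝔤 (D.e α) (D.e (-α)) ≠ 0 := by
  intro h0
  have h := ρ.compact (D.e α) (D.ne_zero α hα)
  rw [D.conj_e α hα, map_neg, h0] at h
  simp at h

theorem WeylBasis.conj_h (D : WeylBasis 𝔥 ρ) {α : LieModule.Weight ℂ 𝔥 𝔤}
    (hα : α.IsNonZero) : ρ.conj (D.h α) = -(D.h α : 𝔤) := by
  have h2 := D.conj_e (-α) hα.neg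
  rw [neg_neg] at h2
  rw [D.coe_h, ρ.map_lie, D.conj_e α hα, h2, neg_lie, lie_neg, neg_neg, lie_skew]

/-- Roots take real values on the elements of `𝔥` which `ρ` maps to their negatives. -/
theorem WeylBasis.star_root_apply (D : WeylBasis 𝔥 ρ) {α : LieModule.Weight ℂ 𝔥 𝔤}
    (hα : α.IsNonZero) {y : 𝔥} (hy : ρ.conj y = -(y : 𝔤)) :
    starRingEnd ℂ (α y) = α y := by
  have h1 := congrArg ρ.conj (D.lie_e α y)
  rw [ρ.map_lie, hy, D.conj_e α hα, LinearMap.map_smulₛₗ, D.conj_e α hα, neg_lie, lie_neg, neg_neg,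
    D.lie_e, LieModule.Weight.coe_neg, Pi.neg_apply, neg_smul, smul_neg, neg_inj] at h1
  exact (smul_left_injective ℂ (D.ne_zero _ hα.neg) h1).symm

variable (b : (LieAlgebra.IsKilling.rootSystem 𝔥).Base)

theorem span_simpleRoots :
    Submodule.span ℂ ((LieAlgebra.IsKilling.rootSystem 𝔥).root '' b.support) = ⊤ := by
  rw [b.span_root_support]
  exact RootPairing.IsRootSystem.span_root_eq_top

/-- The simple roots separate the points of the Cartan subalgebra. -/
theorem cartan_ext {y z : 𝔥} (h : ∀ i ∈ b.support, i.1 y = i.1 z) : y = z := by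
  have key : ∀ f : Module.Dual ℂ 𝔥, f (y - z) = 0 := by
    intro f
    have hf : f ∈ Submodule.span ℂ ((LieAlgebra.IsKilling.rootSystem 𝔥).root '' b.support) := by
      rw [span_simpleRoots b]; trivial
    induction hf using Submodule.span_induction with
    | mem f hf =>
      obtain ⟨i, hi, rfl⟩ := hf
      have := h i hi
      simpa [sub_eq_zero] using this
    | zero => simp
    | add f g _ _ hf hg => simp [hf, hg]
    | smul c f _ hf => simp [hf]
  exact sub_eq_zero.mp ((Module.forall_dual_apply_eq_zero_iff ℂ _).mp key)

/-- The elements `h_i` attached to the simple roots span the Cartan subalgebra. -/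
theorem WeylBasis.exists_eq_sum_h (D : WeylBasis 𝔥 ρ) (y : 𝔥) :
    ∃ c : 𝔥.root → ℂ, y = ∑ i ∈ b.support, c i • D.h i.1 := by
  have hy : LieAlgebra.IsKilling.cartanEquivDual 𝔥 y ∈
      Submodule.span ℂ ((LieAlgebra.IsKilling.rootSystem 𝔥).root '' b.support) := by
    rw [span_simpleRoots b]; trivial
  rw [Submodule.mem_span_image_finset_iff_exists_fun'] at hy
  obtain ⟨c, hc⟩ := hy
  refine ⟨fun i => c i * (killingForm ℂ 𝔤 (D.e i.1) (D.e (-i.1)))⁻¹, ?_⟩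
  apply (LieAlgebra.IsKilling.cartanEquivDual 𝔥).injective
  rw [← hc, map_sum]
  refine Finset.sum_congr rfl fun i _ => ?_
  rw [D.h_eq, smul_smul, mul_assoc,
    inv_mul_cancel₀ (D.killingForm_e_ne_zero (LieSubalgebra.isNonZero_coe_root i)), mul_one,
    map_smul, LinearEquiv.apply_symm_apply]
  rfl

theorem WeylBasis.conj_mem (b : (LieAlgebra.IsKilling.rootSystem 𝔥).Base) (D : WeylBasis 𝔥 ρ)
    (y : 𝔥) : ρ.conj y ∈ 𝔥 := by
  obtain ⟨c, hc⟩ := D.exists_eq_sum_h b y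
  rw [hc, AddSubmonoidClass.coe_finsetSum, map_sum]
  refine sum_mem fun i _ => ?_
  rw [SetLike.val_smul, LinearMap.map_smulₛₗ, D.conj_h (LieSubalgebra.isNonZero_coe_root i)]
  exact 𝔥.smul_mem _ (neg_mem (D.h i.1).2)

/-- The grading element is anti-invariant: `-ρ(x)` takes the value `1` on every simple root. -/
theorem WeylBasis.conj_gradingElement (D : WeylBasis 𝔥 ρ) :
    ρ.conj (gradingElement b : 𝔥) = -((gradingElement b : 𝔥) : 𝔤) := by
  have key : (⟨ρ.conj (gradingElement b : 𝔥), D.conj_mem b _⟩ : 𝔥) = -gradingElement b := by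
    refine cartan_ext b fun i hi => ?_
    have hn := LieSubalgebra.isNonZero_coe_root i
    have h1 := D.lie_e i.1 (gradingElement b)
    rw [root_gradingElement b i hi, one_smul] at h1
    have h2 := congrArg ρ.conj h1
    rw [ρ.map_lie, D.conj_e i.1 hn, lie_neg] at h2
    have h3 := D.lie_e (-i.1) ⟨ρ.conj (gradingElement b : 𝔥), D.conj_mem b _⟩
    rw [neg_inj.mp h2, LieModule.Weight.coe_neg, Pi.neg_apply] at h3
    have h4 := smul_left_injective ℂ (D.ne_zero _ hn.neg) ((one_smul ℂ _).trans h3)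
    have h5 : i.1 (-gradingElement b : 𝔥) = -1 := by
      simp [root_gradingElement b i hi]
    rw [h5, h4, neg_neg]
  exact congrArg Subtype.val key

theorem root_gradingElement_eq_height (i : 𝔥.root) :
    i.1 (gradingElement b) = (b.height i : ℂ) := by
  obtain ⟨f, -, -, hf⟩ := b.exists_root_eq_sum_int i
  rw [RootPairing.Base.height_eq_sum hf]
  have h := LinearMap.congr_fun hf (gradingElement b)
  have h' : i.1 (gradingElement b) = ((LieAlgebra.IsKilling.rootSystem 𝔥).root i)
    (gradingElement b) := by simp
  rw [h', h, LinearMap.sum_apply]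
  push_cast
  refine Finset.sum_congr rfl fun j hj => ?_
  simp [root_gradingElement b j hj]

/-- Root vectors commute if the sum of their roots is neither a root nor zero. -/
theorem WeylBasis.lie_e_e_eq_zero (D : WeylBasis 𝔥 ρ) (α β : LieModule.Weight ℂ 𝔥 𝔤)
    (h0 : α.toLinear + β.toLinear ≠ 0)
    (h : α.toLinear + β.toLinear ∉ Set.range (LieAlgebra.IsKilling.rootSystem 𝔥).root) :
    ⁅D.e α, D.e β⁆ = 0 := by
  have hm := LieAlgebra.lie_mem_genWeightSpace_of_mem_genWeightSpace (D.mem α) (D.mem β)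
  by_contra hne
  have hbot : LieModule.genWeightSpace 𝔤 (⇑α + ⇑β) ≠ ⊥ := by
    intro hb
    have hm' : ⁅D.e α, D.e β⁆ ∈ LieModule.genWeightSpace 𝔤 (⇑α + ⇑β) := hm
    rw [hb] at hm'
    exact hne (by simpa using hm')
  let γ : LieModule.Weight ℂ 𝔥 𝔤 := ⟨⇑α + ⇑β, hbot⟩
  have hγ : γ.toLinear = α.toLinear + β.toLinear := by ext y; rfl
  have hγ0 : γ.IsNonZero := by
    intro hz
    apply h0
    rw [← hγ]
    ext y
    exact congrFun hz y
  exact h ⟨⟨γ, by simpa using hγ0⟩, hγ⟩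

theorem WeylBasis.lie_simple_neg_simple (D : WeylBasis 𝔥 ρ) {i j : 𝔥.root}
    (hi : i ∈ b.support) (hj : j ∈ b.support) (hij : i ≠ j) :
    ⁅D.e i.1, D.e (-j.1)⁆ = 0 := by
  have e : i.1.toLinear + (-j.1).toLinear = (LieAlgebra.IsKilling.rootSystem 𝔥).root i -
    (LieAlgebra.IsKilling.rootSystem 𝔥).root j := by
      simp [sub_eq_add_neg]
  refine D.lie_e_e_eq_zero _ _ ?_ ?_
  · rw [e, sub_ne_zero]
    exact fun h => hij ((LieAlgebra.IsKilling.rootSystem 𝔥).root.injective h)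
  · rw [e]
    exact b.sub_notMem_range_root hi hj

/-- `[E_+, ∑ a_i e_{-i}] = ∑ a_i h_i`, since a difference of distinct simple roots is no root. -/
theorem WeylBasis.lie_ePlus_sum (D : WeylBasis 𝔥 ρ) (a : 𝔥.root → ℂ) :
    ⁅D.ePlus b, ∑ i ∈ b.support, a i • D.e (-i.1)⁆ = ∑ i ∈ b.support, a i • (D.h i.1 : 𝔤) := by
  rw [WeylBasis.ePlus, sum_lie]
  refine Finset.sum_congr rfl fun i hi => ?_
  rw [lie_sum, Finset.sum_eq_single_of_mem i hi, lie_smul, D.coe_h]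
  intro j hj hji
  rw [lie_smul, D.lie_simple_neg_simple b hi hj hji.symm, smul_zero]

theorem neg_nsmul_simple_notMem_closure {i : 𝔥.root} (hi : i ∈ b.support) {n : ℕ} (hn : 0 < n) :
    -(n • (LieAlgebra.IsKilling.rootSystem 𝔥).root i) ∉
      AddSubmonoid.closure ((LieAlgebra.IsKilling.rootSystem 𝔥).root '' b.support) := by
  -- elements of the closure take values `≥ 0` on the grading element
  have key : ∀ f ∈ AddSubmonoid.closure ((LieAlgebra.IsKilling.rootSystem 𝔥).root '' b.support),
      0 ≤ (f (gradingElement b)).re := by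
    intro f hf
    induction hf using AddSubmonoid.closure_induction with
    | mem f hf =>
      obtain ⟨j, hj, rfl⟩ := hf
      simp [root_gradingElement b j hj]
    | zero => simp
    | add f g _ _ hf hg => simpa using add_nonneg hf hg
  intro h
  have := key _ h
  simp [root_gradingElement b i hi] at this
  omega

/-- The highest root plus a simple root is neither a root nor zero. -/
theorem WeylBasis.lie_simple_highest (D : WeylBasis 𝔥 ρ) {ψ : 𝔥.root} (hψ : IsHighestRoot b ψ)
    {i : 𝔥.root} (hi : i ∈ b.support) : ⁅D.e i.1, D.e ψ.1⁆ = 0 := by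
  have e : i.1.toLinear + ψ.1.toLinear = (LieAlgebra.IsKilling.rootSystem 𝔥).root i +
    (LieAlgebra.IsKilling.rootSystem 𝔥).root ψ := by simp
  refine D.lie_e_e_eq_zero _ _ ?_ ?_
  · rw [e]
    intro h
    have h1 := hψ i
    rw [← neg_eq_of_add_eq_zero_right h] at h1
    exact neg_nsmul_simple_notMem_closure b hi two_pos (by
      rwa [show -(2 • (LieAlgebra.IsKilling.rootSystem 𝔥).root i) =
        -(LieAlgebra.IsKilling.rootSystem 𝔥).root i -
          (LieAlgebra.IsKilling.rootSystem 𝔥).root i by abel])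
  · rw [e]
    rintro ⟨β, hβ⟩
    have h1 := hψ β
    rw [hβ] at h1
    exact neg_nsmul_simple_notMem_closure b hi one_pos (by
      rwa [show -(1 • (LieAlgebra.IsKilling.rootSystem 𝔥).root i) =
        (LieAlgebra.IsKilling.rootSystem 𝔥).root ψ - ((LieAlgebra.IsKilling.rootSystem 𝔥).root i +
          (LieAlgebra.IsKilling.rootSystem 𝔥).root ψ) by abel])

/-- This is the image under `ρ` of the relation `[e_i, e_ψ] = 0`. -/
theorem WeylBasis.lie_neg_highest_neg_simple (D : WeylBasis 𝔥 ρ) {ψ : 𝔥.root}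
    (hψ : IsHighestRoot b ψ) {i : 𝔥.root} (hi : i ∈ b.support) :
    ⁅D.e (-ψ.1), D.e (-i.1)⁆ = 0 := by
  have h := congrArg ρ.conj (D.lie_simple_highest b hψ hi)
  rw [ρ.map_lie, D.conj_e _ (LieSubalgebra.isNonZero_coe_root i),
    D.conj_e _ (LieSubalgebra.isNonZero_coe_root ψ), neg_lie, lie_neg, neg_neg, map_zero] at h
  rw [← lie_skew, h, neg_zero]

end LieTheory

/-! ### Integrality for `sl₂`-triples -/

/-- In a finite-dimensional module the neutral element of an `sl₂`-triple has integral eigenvalues: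
raising an eigenvector as far as possible yields a primitive vector. -/
theorem exists_int_of_sl2Triple {L M : Type*} [LieRing L] [LieAlgebra ℂ L] [AddCommGroup M]
    [Module ℂ M] [LieRingModule L M] [LieModule ℂ L M] [FiniteDimensional ℂ M] {h e f : L}
    (t : IsSl2Triple h e f) {v : M} {μ : ℂ} (hv : v ≠ 0) (hμ : ⁅h, v⁆ = μ • v) :
    ∃ n : ℤ, μ = n := by
  let w : ℕ → M := fun n => ((LieModule.toEnd ℂ L M e) ^ n) v
  have hw : ∀ n, ⁅e, w n⁆ = w (n + 1) := fun n => by simp [w, pow_succ']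
  have hh : ∀ n : ℕ, ⁅h, w n⁆ = (μ + 2 * n) • w n := by
    intro n
    induction n with
    | zero => simpa [w] using hμ
    | succ n ih =>
      rw [← hw n, leibniz_lie h, t.lie_h_e_smul ℂ, ih, lie_smul, smul_lie, ← add_smul]
      congr 1
      push_cast
      ring
  -- otherwise `h` would have infinitely many eigenvalues `μ + 2n`
  obtain ⟨k, hk⟩ : ∃ n, w n = 0 := by
    have hs : (Set.range fun n : ℕ => μ + 2 * n).Infinite := by
      rw [Set.infinite_range_iff (fun n m h => by simpa using h)]
      infer_instance
    by_contra! hne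
    refine hs (Set.Finite.subset
      (Module.End.finite_hasEigenvalue (LieModule.toEnd ℂ L M h)) ?_)
    rintro _ ⟨n, rfl⟩
    exact Module.End.hasEigenvalue_of_hasEigenvector
      (Module.End.hasEigenvector_iff.mpr ⟨Module.End.mem_eigenspace_iff.mpr (hh n), hne n⟩)
  obtain ⟨n, hn₁, hn₂⟩ := Nat.exists_not_and_succ_of_not_zero_of_exists
    (p := fun n => w n = 0) (by simpa [w] using hv) ⟨k, hk⟩
  have P : t.HasPrimitiveVectorWith (w n) (μ + 2 * n) := ⟨hn₁, hh n, by rw [hw, hn₂]⟩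
  obtain ⟨m, hm⟩ := P.exists_nat
  refine ⟨m - 2 * n, ?_⟩
  push_cast
  rw [← hm]
  ring

/-! ### Unitary representations -/

section Representation

variable {𝔤 : Type*} [LieRing 𝔤] [LieAlgebra ℂ 𝔤]
  {ρ : CompactConjugation 𝔤} {V : Type*} [NormedAddCommGroup V] [InnerProductSpace ℂ V]

theorem UnitaryRep.commute (π : UnitaryRep ρ V) {y z : 𝔤} (h : ⁅y, z⁆ = 0) :
    Commute (π.map y) (π.map z) := by
  have := π.map_lie y z
  rw [h, map_zero] at this
  exact (sub_eq_zero.mp this.symm)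

theorem UnitaryRep.adjoint_map [CompleteSpace V] (π : UnitaryRep ρ V) (y : 𝔤) :
    ContinuousLinearMap.adjoint (π.map y) = -π.map (ρ.conj y) := by
  symm
  rw [ContinuousLinearMap.eq_adjoint_iff]
  intro v w
  have h := π.unitary y w v
  have h2 := congrArg (starRingEnd ℂ) h
  rw [map_neg, inner_conj_symm, inner_conj_symm] at h2
  simp [h2]

theorem UnitaryRep.isSelfAdjoint [CompleteSpace V] (π : UnitaryRep ρ V) {y : 𝔤}
    (hy : ρ.conj y = -y) : IsSelfAdjoint (π.map y) := by
  rw [IsSelfAdjoint, ContinuousLinearMap.star_eq_adjoint, π.adjoint_map, hy, map_neg, neg_neg]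

/-- `e^S T = e^c T e^S` if `[S, T] = c T`. -/
theorem exp_mul_of_commutator {A : Type*} [NormedRing A] [NormedAlgebra ℂ A] [CompleteSpace A]
    {S T : A} {c : ℂ} (h : S * T - T * S = c • T) :
    NormedSpace.exp S * T = Complex.exp c • (T * NormedSpace.exp S) := by
  let _ : NormedAlgebra ℚ A := NormedAlgebra.restrictScalars ℚ ℂ A
  have hs : SemiconjBy T (S + algebraMap ℂ A c) S := by
    rw [SemiconjBy, mul_add, ← Algebra.commutes, ← Algebra.smul_def, ← h]
    abel
  have h2 := hs.exp_right
  rw [NormedSpace.exp_add_of_commute (Algebra.commutes c S).symm,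
    ← NormedSpace.algebraMap_exp_comm, ← Complex.exp_eq_exp_ℂ, SemiconjBy, ← Algebra.commutes,
    ← Algebra.smul_def, mul_smul_comm] at h2
  exact h2.symm

variable [FiniteDimensional ℂ 𝔤] [LieAlgebra.IsKilling ℂ 𝔤]
  {𝔥 : LieSubalgebra ℂ 𝔤} [𝔥.IsCartanSubalgebra]

theorem UnitaryRep.commute_cartan (π : UnitaryRep ρ V) (y z : 𝔥) :
    Commute (π.map (y : 𝔤)) (π.map (z : 𝔤)) := by
  refine π.commute ?_
  have : ⁅y, z⁆ = 0 := LieModule.IsTrivial.trivial y z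
  simpa using congrArg Subtype.val this

theorem UnitaryRep.exp_mul_e [CompleteSpace V] (π : UnitaryRep ρ V) (D : WeylBasis 𝔥 ρ)
    (α : LieModule.Weight ℂ 𝔥 𝔤) (y : 𝔥) (t : ℂ) :
    NormedSpace.exp (t • π.map (y : 𝔤)) * π.map (D.e α)
      = Complex.exp (t * α y) • (π.map (D.e α) * NormedSpace.exp (t • π.map (y : 𝔤))) := by
  refine exp_mul_of_commutator ?_
  rw [smul_mul_assoc, mul_smul_comm, ← smul_sub, ← π.map_lie, D.lie_e, map_smul, smul_smul]

/-- The principal `sl₂`-triple `(2x, E_+, ∑ c_i e_{-i})`, where `2x = ∑ c_i h_i`, makes the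
eigenvalues of `π(x)` half-integral. -/
theorem UnitaryRep.exists_int_eigenvalue [FiniteDimensional ℂ V] (π : UnitaryRep ρ V)
    (D : WeylBasis 𝔥 ρ) (b : (LieAlgebra.IsKilling.rootSystem 𝔥).Base) {a : ℂ}
    (ha : Module.End.HasEigenvalue (π.map (gradingElement b : 𝔤) : V →ₗ[ℂ] V) a) :
    ∃ n : ℤ, 2 * a = n := by
  obtain ⟨v, hv⟩ := ha.exists_hasEigenvector
  have hva : π.map (gradingElement b : 𝔤) v = a • v := hv.apply_eq_smul
  obtain ⟨c, hc⟩ := D.exists_eq_sum_h b ((2 : ℂ) • gradingElement b)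
  let F : 𝔤 := ∑ i ∈ b.support, c i • D.e (-i.1)
  have hE : ⁅(gradingElement b : 𝔤), D.ePlus b⁆ = D.ePlus b := by
    rw [WeylBasis.ePlus, lie_sum]
    refine Finset.sum_congr rfl fun i hi => ?_
    rw [D.lie_e, root_gradingElement b i hi, one_smul]
  have hF : ⁅(gradingElement b : 𝔤), F⁆ = -F := by
    rw [lie_sum, ← Finset.sum_neg_distrib]
    refine Finset.sum_congr rfl fun i hi => ?_
    rw [lie_smul, D.lie_e, LieModule.Weight.coe_neg, Pi.neg_apply, root_gradingElement b i hi,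
      neg_one_smul, smul_neg]
  have hEF : ⁅D.ePlus b, F⁆ = (2 : ℂ) • (gradingElement b : 𝔤) := by
    rw [← SetLike.val_smul, hc, AddSubmonoidClass.coe_finsetSum, D.lie_ePlus_sum b]
    simp only [SetLike.val_smul]
  let _ : LieRing (Module.End ℂ V) := LieRing.ofAssociativeRing
  let T : 𝔤 →ₗ[ℂ] Module.End ℂ V := ContinuousLinearMap.coeLM ℂ ∘ₗ π.map
  have hT : ∀ y z, ⁅T y, T z⁆ = T ⁅y, z⁆ := fun y z => by
    ext w
    simp [T, π.map_lie, Ring.lie_def]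
  rcases eq_or_ne (T ((2 : ℂ) • (gradingElement b : 𝔤))) 0 with h0 | h0
  · refine ⟨0, ?_⟩
    have h1 := LinearMap.congr_fun h0 v
    have h2 : (2 * a) • v = 0 := by simpa [T, hva, smul_smul] using h1
    simpa [hv.2] using h2
  · have t : IsSl2Triple (T ((2 : ℂ) • (gradingElement b : 𝔤))) (T (D.ePlus b)) (T F) := by
      refine ⟨h0, ?_, ?_, ?_⟩
      · rw [hT, hEF]
      · rw [hT, smul_lie, hE, map_smul, two_smul, two_nsmul]
      · rw [hT, smul_lie, hF, map_smul, map_neg, two_smul, two_nsmul, ← neg_add]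
    refine exists_int_of_sl2Triple t hv.2 ?_
    simp [T, hva, smul_smul]

end Representation

/-! ### Wirtinger calculus and exponentials -/

section Calculus

theorem differentiableOn_complex_of_dzbar_eq_zero {f : ℂ → ℂ} {s : Set ℂ} (hs : IsOpen s)
    (hf : ContDiffOn ℝ ∞ f s) (h : ∀ z ∈ s, dzbar f z = 0) : DifferentiableOn ℂ f s := by
  intro z hz
  refine (differentiableAt_complex_iff_differentiableAt_real.mpr
    ⟨(hf.contDiffAt (hs.mem_nhds hz)).differentiableAt (by simp), ?_⟩).differentiableWithinAt
  have h1 := h z hz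
  rw [dzbar, smul_eq_zero_iff_right (by norm_num)] at h1
  rw [eq_neg_of_add_eq_zero_left h1, smul_neg, smul_smul]
  simp

theorem dzbar_eq_zero_of_differentiableAt {f : ℂ → ℂ} {z : ℂ} (h : DifferentiableAt ℂ f z) :
    dzbar f z = 0 := by
  rw [dzbar, (differentiableAt_complex_iff_differentiableAt_real.mp h).2, smul_smul]
  simp

theorem fderiv_fderiv_apply {f : ℂ → ℂ} {z : ℂ} (hf : ContDiffAt ℝ 2 f z) (v w : ℂ) :
    fderiv ℝ (fun y => fderiv ℝ f y v) z w = fderiv ℝ (fderiv ℝ f) z w v := by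
  rw [fderiv_clm_apply ((hf.fderiv_right (m := 1) le_rfl).differentiableAt one_ne_zero)
    (differentiableAt_const v)]
  simp

theorem differentiableAt_fderiv_apply {f : ℂ → ℂ} {z : ℂ} (hf : ContDiffAt ℝ 2 f z) (v : ℂ) :
    DifferentiableAt ℝ (fun y => fderiv ℝ f y v) z :=
  ((hf.fderiv_right (m := 1) le_rfl).differentiableAt one_ne_zero).clm_apply
    (differentiableAt_const v)

theorem differentiableAt_dz {f : ℂ → ℂ} {z : ℂ} (hf : ContDiffAt ℝ 2 f z) :
    DifferentiableAt ℝ (dz f) z :=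
  ((differentiableAt_fderiv_apply hf 1).sub
    ((differentiableAt_fderiv_apply hf Complex.I).const_smul Complex.I)).const_smul (1 / 2 : ℂ)

/-- `4 ∂_z ∂_{z̄} = ∂_x^2 + ∂_y^2`. -/
theorem dz_dzbar_eq {f : ℂ → ℂ} {z : ℂ} (hf : ContDiffAt ℝ 2 f z) :
    dz (dzbar f) z = (1 / 4 : ℂ) * (fderiv ℝ (fderiv ℝ f) z 1 1
      + fderiv ℝ (fderiv ℝ f) z Complex.I Complex.I) := by
  have hsymm : fderiv ℝ (fderiv ℝ f) z Complex.I 1 = fderiv ℝ (fderiv ℝ f) z 1 Complex.I :=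
    (hf.isSymmSndFDerivAt (by simp)).eq _ _
  have h1 := differentiableAt_fderiv_apply hf 1
  have h2 := differentiableAt_fderiv_apply hf Complex.I
  have h : ∀ w, fderiv ℝ (dzbar f) z w = (1 / 2 : ℂ) * (fderiv ℝ (fderiv ℝ f) z w 1
      + Complex.I * fderiv ℝ (fderiv ℝ f) z w Complex.I) := by
    intro w
    have : dzbar f = fun y => (1 / 2 : ℂ) • (fderiv ℝ f y 1 + Complex.I • fderiv ℝ f y Complex.I) :=
      rfl
    rw [this, fderiv_fun_const_smul (h1.fun_add (h2.fun_const_smul _)),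
      fderiv_fun_add h1 (h2.fun_const_smul _), fderiv_fun_const_smul h2]
    simp [fderiv_fderiv_apply hf, mul_add]
  rw [dz, h, h, hsymm]
  simp only [smul_eq_mul]
  linear_combination (-1 / 4 : ℂ) * fderiv ℝ (fderiv ℝ f) z Complex.I Complex.I * Complex.I_sq

theorem dzbar_dz_eq {f : ℂ → ℂ} {z : ℂ} (hf : ContDiffAt ℝ 2 f z) :
    dzbar (dz f) z = dz (dzbar f) z := by
  have hsymm : fderiv ℝ (fderiv ℝ f) z Complex.I 1 = fderiv ℝ (fderiv ℝ f) z 1 Complex.I :=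
    (hf.isSymmSndFDerivAt (by simp)).eq _ _
  have h1 := differentiableAt_fderiv_apply hf 1
  have h2 := differentiableAt_fderiv_apply hf Complex.I
  have h : ∀ w, fderiv ℝ (dz f) z w = (1 / 2 : ℂ) * (fderiv ℝ (fderiv ℝ f) z w 1
      - Complex.I * fderiv ℝ (fderiv ℝ f) z w Complex.I) := by
    intro w
    have : dz f = fun y => (1 / 2 : ℂ) • (fderiv ℝ f y 1 - Complex.I • fderiv ℝ f y Complex.I) :=
      rfl
    rw [this, fderiv_fun_const_smul (h1.fun_sub (h2.fun_const_smul _)),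
      fderiv_fun_sub h1 (h2.fun_const_smul _), fderiv_fun_const_smul h2]
    simp [fderiv_fderiv_apply hf]
  rw [dz_dzbar_eq hf, dzbar, h, h, hsymm]
  simp only [smul_eq_mul]
  linear_combination (-1 / 4 : ℂ) * fderiv ℝ (fderiv ℝ f) z Complex.I Complex.I * Complex.I_sq

variable {A : Type*} [NormedRing A] [NormedAlgebra ℂ A] [CompleteSpace A] {ι : Type*} [Fintype ι]

/-- Along a family of commuting elements `exp` has the logarithmic derivative of the scalar case:
`exp (B(z)) = exp (B(z₀)) exp (B(z) - B(z₀))`, and `exp` has derivative `1` at `0`. -/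
theorem hasFDerivAt_exp_sum (a : ι → A) (ha : ∀ i j, Commute (a i) (a j)) {f : ι → ℂ → ℂ} {z : ℂ}
    {f' : ι → ℂ →L[ℝ] ℂ} (hf : ∀ i, HasFDerivAt (f i) (f' i) z) :
    HasFDerivAt (fun y => NormedSpace.exp (∑ i, f i y • a i))
      (NormedSpace.exp (∑ i, f i z • a i) • ∑ i, (f' i).smulRight (a i)) z := by
  let _ : NormedAlgebra ℚ A := NormedAlgebra.restrictScalars ℚ ℂ A
  have hcomm : ∀ g h : ι → ℂ, Commute (∑ i, g i • a i) (∑ i, h i • a i) := fun g h =>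
    Commute.sum_left _ _ _ fun i _ => Commute.sum_right _ _ _ fun j _ =>
      ((ha i j).smul_left _).smul_right _
  have hB : HasFDerivAt (fun y => ∑ i, (f i y - f i z) • a i) (∑ i, (f' i).smulRight (a i)) z :=
    HasFDerivAt.fun_sum fun i _ => ((hf i).sub_const (f i z)).smul_const (a i)
  have hexp : HasFDerivAt (NormedSpace.exp : A → A) (1 : A →L[ℝ] A)
      (∑ i, (f i z - f i z) • a i) := by
    simpa using hasFDerivAt_exp_zero (𝕂 := ℝ) (𝔸 := A)
  have h := (hexp.comp z hB).const_mul (NormedSpace.exp (∑ i, f i z • a i))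
  refine (h.congr_of_eventuallyEq (Filter.Eventually.of_forall fun y => ?_)).congr_fderiv ?_
  · have e : ∑ i, f i y • a i = ∑ i, f i z • a i + ∑ i, (f i y - f i z) • a i := by
      simp [sub_smul]
    simp only [Function.comp]
    rw [← NormedSpace.exp_add_of_commute (hcomm _ _), ← e]
  · ext1 w
    simp

variable {V : Type*} [NormedAddCommGroup V] [InnerProductSpace ℂ V] [CompleteSpace V]

theorem chernForm_exp_sum (a : ι → V →L[ℂ] V) (ha : ∀ i j, Commute (a i) (a j)) {f : ι → ℂ → ℂ}
    {z : ℂ} (hf : ∀ i, DifferentiableAt ℝ (f i) z) :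
    chernForm (fun y => NormedSpace.exp (∑ i, f i y • a i)) z = ∑ i, dz (f i) z • a i := by
  let _ : NormedAlgebra ℚ (V →L[ℂ] V) := NormedAlgebra.restrictScalars ℚ ℂ _
  have h := (hasFDerivAt_exp_sum a ha fun i => (hf i).hasFDerivAt).fderiv
  have hu : IsUnit (NormedSpace.exp (∑ i, f i z • a i)) := NormedSpace.isUnit_exp _
  have e : dz (fun y => NormedSpace.exp (∑ i, f i y • a i)) z
      = NormedSpace.exp (∑ i, f i z • a i) * ∑ i, dz (f i) z • a i := by
    simp only [dz, h, smul_apply, smul_eq_mul, ← mul_smul_comm, ← mul_sub]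
    congr 1
    simp [Finset.smul_sum, smul_smul, ← Finset.sum_sub_distrib,
      sub_smul, smul_sub, mul_sub]
  rw [chernForm, e, ← mul_assoc, Ring.inverse_mul_cancel _ hu, one_mul]

/-- The curvature of the Chern connection of `e^B` is `-∂_z ∂_{z̄} B` for commuting `B`. -/
theorem curvature_chernForm_exp_sum (a : ι → V →L[ℂ] V) (ha : ∀ i j, Commute (a i) (a j))
    {f : ι → ℂ → ℂ} {z : ℂ} (hf : ∀ i, ContDiffAt ℝ 2 (f i) z) :
    curvature (chernForm fun y => NormedSpace.exp (∑ i, f i y • a i)) 0 z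
      = -∑ i, dz (dzbar (f i)) z • a i := by
  have hev : chernForm (fun y => NormedSpace.exp (∑ i, f i y • a i))
      =ᶠ[nhds z] fun y => ∑ i, dz (f i) y • a i := by
    have h1 : ∀ᶠ y in nhds z, ∀ i, ContDiffAt ℝ 2 (f i) y :=
      Filter.eventually_all.mpr fun i => (hf i).eventually (by simp)
    filter_upwards [h1] with y hy
    exact chernForm_exp_sum a ha fun i => (hy i).differentiableAt two_ne_zero
  have hd : ∀ i, DifferentiableAt ℝ (dz (f i)) z := fun i => differentiableAt_dz (hf i)
  have hsum : HasFDerivAt (fun y => ∑ i, dz (f i) y • a i)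
      (∑ i, (fderiv ℝ (dz (f i)) z).smulRight (a i)) z :=
    HasFDerivAt.fun_sum fun i _ => (hd i).hasFDerivAt.smul_const (a i)
  have e : dzbar (chernForm fun y => NormedSpace.exp (∑ i, f i y • a i)) z
      = ∑ i, dzbar (dz (f i)) z • a i := by
    rw [dzbar, hev.fderiv_eq, hsum.fderiv]
    simp [dzbar, Finset.smul_sum, smul_smul,
      ← Finset.sum_add_distrib, add_smul, mul_add]
  have h0 : dz (0 : ℂ → V →L[ℂ] V) z = 0 := by simp [dz]
  rw [curvature, h0, e]
  simp [dzbar_dz_eq (hf _)]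

end Calculus

/-! ### Roots of the canonical cocycle -/

section Cocycle

variable {X : Type*} [TopologicalSpace X] [ChartedSpace ℂ X]

theorem isOpen_coordDomain {U : Set X} (hU : IsOpen U) (c : atlas ℂ X) :
    IsOpen (coordDomain U c) :=
  c.1.isOpen_inter_preimage_symm hU

theorem coordDomain_mono {U W : Set X} (h : W ⊆ U) (c : atlas ℂ X) :
    coordDomain W c ⊆ coordDomain U c :=
  fun _ hz => ⟨hz.1, h hz.2⟩

theorem mem_coordDomain {U : Set X} {c : atlas ℂ X} {p : X} (hp : p ∈ U ∩ c.1.source) :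
    c.1 p ∈ coordDomain U c :=
  ⟨c.1.map_source hp.2, by simpa [c.1.left_inv hp.2] using hp.1⟩

theorem jac_self {c : atlas ℂ X} {p : X} (hp : p ∈ c.1.source) : jac c c p = 1 := by
  have h : (fun z => c.1 (c.1.symm z)) =ᶠ[nhds (c.1 p)] id := by
    filter_upwards [c.1.open_target.mem_nhds (c.1.map_source hp)] with z hz
    exact c.1.right_inv hz
  rw [jac, h.deriv_eq, deriv_id]

variable {U : Set X} {N : ℕ} {κ : atlas ℂ X → atlas ℂ X → X → ℂ}

theorem IsCanonicalRoot.mono {W : Set X} (hκ : IsCanonicalRoot U N κ) (h : W ⊆ U) :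
    IsCanonicalRoot W N κ where
  holomorphic c c' := (hκ.holomorphic c c').mono
    (coordDomain_mono (Set.inter_subset_inter_left _ h) c')
  pow_eq c c' p hp := hκ.pow_eq c c' p ⟨⟨h hp.1.1, hp.1.2⟩, hp.2⟩
  cocycle c c' c'' p hp := hκ.cocycle c c' c'' p ⟨⟨⟨h hp.1.1.1, hp.1.1.2⟩, hp.1.2⟩, hp.2⟩

/-- `κ_{cc'} κ_{c'c} = κ_{cc}`, and `κ_{cc}` is a root of `k_{cc} = 1`. -/
theorem IsCanonicalRoot.ne_zero (hκ : IsCanonicalRoot U N κ) (hN : N ≠ 0) {c c' : atlas ℂ X}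
    {p : X} (hp : p ∈ U ∩ c.1.source ∩ c'.1.source) : κ c c' p ≠ 0 := by
  intro h0
  have h1 := hκ.cocycle c c' c p ⟨hp, hp.1.2⟩
  have h2 := hκ.pow_eq c c p ⟨hp.1, hp.1.2⟩
  rw [← h1, h0, zero_mul, zero_pow hN, jac_self hp.1.2] at h2
  exact zero_ne_one h2

theorem IsCanonicalRoot.self (hκ : IsCanonicalRoot U N κ) (hN : N ≠ 0) {c : atlas ℂ X}
    {p : X} (hp : p ∈ U ∩ c.1.source) : κ c c p = 1 :=
  (mul_eq_left₀ (hκ.ne_zero hN ⟨hp, hp.2⟩)).mp (hκ.cocycle c c c p ⟨⟨hp, hp.2⟩, hp.2⟩)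

theorem IsCanonicalRoot.jac_ne_zero (hκ : IsCanonicalRoot U N κ) (hN : N ≠ 0) {c c' : atlas ℂ X}
    {p : X} (hp : p ∈ U ∩ c.1.source ∩ c'.1.source) : jac c c' p ≠ 0 := by
  rw [← hκ.pow_eq c c' p hp]
  exact pow_ne_zero _ (hκ.ne_zero hN hp)

theorem IsCanonicalRoot.jac_mul_jac (hκ : IsCanonicalRoot U N κ) {c c' c'' : atlas ℂ X} {p : X}
    (hp : p ∈ U ∩ c.1.source ∩ c'.1.source ∩ c''.1.source) :
    jac c c' p * jac c' c'' p = jac c c'' p := by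
  rw [← hκ.pow_eq c c' p hp.1, ← hκ.pow_eq c' c'' p ⟨⟨hp.1.1.1, hp.1.2⟩, hp.2⟩,
    ← hκ.pow_eq c c'' p ⟨hp.1.1, hp.2⟩, ← mul_pow, hκ.cocycle c c' c'' p hp]

theorem IsCanonicalRoot.holomorphic_zpow (hκ : IsCanonicalRoot U N κ) (hN : N ≠ 0)
    (c c' : atlas ℂ X) (m : ℤ) : DifferentiableOn ℂ (fun z => κ c c' (c'.1.symm z) ^ m)
      (coordDomain (U ∩ c.1.source) c') := by
  intro z hz
  have hne : κ c c' (c'.1.symm z) ≠ 0 := hκ.ne_zero hN ⟨hz.2, c'.1.map_target hz.1⟩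
  exact (hκ.holomorphic c c' z hz).zpow (Or.inl hne)

end Cocycle

/-! ### The bundle `k^{π(x)}` -/

section Bundle

variable {X : Type*} [TopologicalSpace X] [ChartedSpace ℂ X]
  {𝔤 : Type*} [LieRing 𝔤] [LieAlgebra ℂ 𝔤] [FiniteDimensional ℂ 𝔤] [LieAlgebra.IsKilling ℂ 𝔤]
  {𝔥 : LieSubalgebra ℂ 𝔤} [𝔥.IsCartanSubalgebra]
  {ρ : CompactConjugation 𝔤} (D : WeylBasis 𝔥 ρ) (b : (LieAlgebra.IsKilling.rootSystem 𝔥).Base)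
  {V : Type*} [NormedAddCommGroup V] [InnerProductSpace ℂ V] [CompleteSpace V] (π : UnitaryRep ρ V)

theorem exp_apply_of_eigenvector {S : V →L[ℂ] V} {v : V} {a : ℂ} (h : S v = a • v) :
    NormedSpace.exp S v = Complex.exp a • v := by
  rcases eq_or_ne v 0 with rfl | hv
  · simp
  -- the operator `T = ⟪v, ·⟫ v` satisfies `S T = a T`
  let _ : NormedAlgebra ℚ (V →L[ℂ] V) := NormedAlgebra.restrictScalars ℚ ℂ _
  let T : V →L[ℂ] V := (innerSL ℂ v).smulRight v
  have hT : SemiconjBy T (algebraMap ℂ (V →L[ℂ] V) a) S := by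
    rw [SemiconjBy, ← Algebra.commutes, ← Algebra.smul_def]
    ext w
    simp [T, h, smul_smul, mul_comm]
  have h2 := hT.exp_right
  rw [← NormedSpace.algebraMap_exp_comm, ← Complex.exp_eq_exp_ℂ, SemiconjBy, ← Algebra.commutes,
    ← Algebra.smul_def] at h2
  have h3 := congrArg (fun R : V →L[ℂ] V => R v) h2
  have hvv : ⟪v, v⟫_ℂ ≠ 0 := inner_self_ne_zero.mpr hv
  simp only [smul_apply, mul_apply_eq_comp, T, ContinuousLinearMap.smulRight_apply,
    innerSL_apply_apply, map_smul] at h3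
  rw [smul_comm] at h3
  exact (smul_right_injective V hvv h3).symm

variable {U : Set X} {N : ℕ} {κ : atlas ℂ X → atlas ℂ X → X → ℂ}

/-- In an orthonormal basis of eigenvectors of `π(x)` the transition functions are diagonal with
integral powers of `κ` as entries; this is what makes them independent of the branch of `log κ`. -/
theorem exists_basis_todaBundle [FiniteDimensional ℂ V]
    (hN : ∀ a : ℂ, Module.End.HasEigenvalue (π.map (gradingElement b : 𝔤) : V →ₗ[ℂ] V) a →
      ∃ n : ℤ, N * a = n) (hx : ρ.conj (gradingElement b : 𝔥) = -((gradingElement b : 𝔥) : 𝔤)) :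
    ∃ (e : OrthonormalBasis (Fin (Module.finrank ℂ V)) ℂ V) (m : Fin (Module.finrank ℂ V) → ℤ),
      ∀ (κ : atlas ℂ X → atlas ℂ X → X → ℂ) (c c' : atlas ℂ X) (p : X), κ c c' p ≠ 0 →
        ∀ i, todaBundle b π N κ c c' p (e i) = κ c c' p ^ m i • e i := by
  have hS : (π.map (gradingElement b : 𝔤) : V →ₗ[ℂ] V).IsSymmetric :=
    ContinuousLinearMap.isSelfAdjoint_iff_isSymmetric.mp (π.isSelfAdjoint hx)
  choose m hm using fun i => hN _ (hS.hasEigenvalue_eigenvalues rfl i)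
  refine ⟨hS.eigenvectorBasis rfl, m, fun κ c c' p hκ i => ?_⟩
  have h1 : π.map (gradingElement b : 𝔤) (hS.eigenvectorBasis rfl i)
      = (hS.eigenvalues rfl i : ℂ) • hS.eigenvectorBasis rfl i := hS.apply_eigenvectorBasis rfl i
  rw [todaBundle, exp_apply_of_eigenvector (a := m i * Complex.log (κ c c' p)),
    Complex.exp_int_mul, Complex.exp_log hκ]
  rw [smul_apply, h1, smul_smul, ← hm i]
  congr 1
  simp only [Complex.coe_algebraMap]
  ring

theorem isHolomorphicBundle_todaBundle [FiniteDimensional ℂ V] (hκ : IsCanonicalRoot U N κ)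
    (hN0 : N ≠ 0)
    (hN : ∀ a : ℂ, Module.End.HasEigenvalue (π.map (gradingElement b : 𝔤) : V →ₗ[ℂ] V) a →
      ∃ n : ℤ, N * a = n) (hx : ρ.conj (gradingElement b : 𝔥) = -((gradingElement b : 𝔥) : 𝔤)) :
    IsHolomorphicBundle U (todaBundle b π N κ) := by
  obtain ⟨e, m, he⟩ := exists_basis_todaBundle (X := X) b π hN hx
  replace he := he κ
  have ext_e : ∀ {S T : V →L[ℂ] V}, (∀ i, S (e i) = T (e i)) → S = T := fun h =>
    ContinuousLinearMap.coe_injective (e.toBasis.ext fun i => by simpa using h i)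
  refine ⟨fun c c' => ?_, fun c p hp => ?_, fun c c' c'' p hp => ?_⟩
  · have hsum : DifferentiableOn ℂ
        (fun z => ∑ i, κ c c' (c'.1.symm z) ^ m i • (innerSL ℂ (e i)).smulRight (e i))
        (coordDomain (U ∩ c.1.source) c') :=
      DifferentiableOn.fun_sum fun i _ => (hκ.holomorphic_zpow hN0 c c' (m i)).smul_const _
    refine hsum.congr fun z hz => ext_e fun j => ?_
    rw [he _ _ _ (hκ.ne_zero hN0 ⟨hz.2, c'.1.map_target hz.1⟩)]
    simp [sum_apply, e.inner_eq_ite]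
  · refine ext_e fun i => ?_
    rw [he _ _ _ (hκ.ne_zero hN0 ⟨hp, hp.2⟩), hκ.self hN0 hp]
    simp
  · refine ext_e fun i => ?_
    rw [mul_apply_eq_comp, he _ _ _ (hκ.ne_zero hN0 ⟨⟨hp.1.1.1, hp.1.2⟩, hp.2⟩),
      map_smul, he _ _ _ (hκ.ne_zero hN0 hp.1), he _ _ _ (hκ.ne_zero hN0 ⟨hp.1.1, hp.2⟩),
      smul_smul, ← mul_zpow, mul_comm, hκ.cocycle c c' c'' p hp]

end Bundle

/-! ### The metric `e^Φ` -/

section Metric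

variable {X : Type*} [TopologicalSpace X] [ChartedSpace ℂ X]
  {𝔤 : Type*} [LieRing 𝔤] [LieAlgebra ℂ 𝔤] [FiniteDimensional ℂ 𝔤] [LieAlgebra.IsKilling ℂ 𝔤]
  {𝔥 : LieSubalgebra ℂ 𝔤} [𝔥.IsCartanSubalgebra]
  {ρ : CompactConjugation 𝔤} (D : WeylBasis 𝔥 ρ) (b : (LieAlgebra.IsKilling.rootSystem 𝔥).Base)
  {V : Type*} [NormedAddCommGroup V] [InnerProductSpace ℂ V] [CompleteSpace V] (π : UnitaryRep ρ V)
  {U : Set X} {N : ℕ} {κ : atlas ℂ X → atlas ℂ X → X → ℂ} {φ : atlas ℂ X → b.support → X → ℝ}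

theorem IsTodaField.mono {W : Set X} (hφ : IsTodaField D b U φ) (h : W ⊆ U) :
    IsTodaField D b W φ where
  smooth c i := (hφ.smooth c i).mono (coordDomain_mono h c)
  transform c c' p hp := hφ.transform c c' p ⟨⟨h hp.1.1, hp.1.2⟩, hp.2⟩

theorem conj_cartanField (φ : atlas ℂ X → b.support → X → ℝ) (c : atlas ℂ X) (p : X) :
    ρ.conj (cartanField D b φ c p) = -(cartanField D b φ c p : 𝔤) := by
  rw [cartanField, AddSubmonoidClass.coe_finsetSum, map_sum, ← Finset.sum_neg_distrib]
  refine Finset.sum_congr rfl fun i _ => ?_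
  rw [SetLike.val_smul, LinearMap.map_smulₛₗ, D.conj_h (LieSubalgebra.isNonZero_coe_root i.1),
    Complex.conj_ofReal, smul_neg]

theorem root_cartanField_re (φ : atlas ℂ X → b.support → X → ℝ) (c : atlas ℂ X) (p : X)
    (i : 𝔥.root) :
    ((i.1 (cartanField D b φ c p)).re : ℂ) = i.1 (cartanField D b φ c p) :=
  Complex.conj_eq_iff_re.mp
    (D.star_root_apply (LieSubalgebra.isNonZero_coe_root i) (conj_cartanField D b φ c p))

theorem todaMetric_eq (φ : atlas ℂ X → b.support → X → ℝ) (c : atlas ℂ X) (p : X) :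
    todaMetric D b π φ c p
      = NormedSpace.exp (∑ i, (φ c i p : ℂ) • π.map (D.h i.1.1 : 𝔤)) := by
  rw [todaMetric, cartanField, AddSubmonoidClass.coe_finsetSum, map_sum]
  simp only [SetLike.val_smul, map_smul]

/-- The transformation law of a Toda field, `Φ_{c'} = Φ_c + 2 log |k_{cc'}| x`. -/
theorem cartanField_transform (hφ : IsTodaField D b U φ) {c c' : atlas ℂ X} {p : X}
    (hp : p ∈ U ∩ c.1.source ∩ c'.1.source) (hj : jac c c' p ≠ 0) :
    cartanField D b φ c' p
      = cartanField D b φ c p + ((2 * Real.log ‖jac c c' p‖ : ℝ) : ℂ) • gradingElement b := by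
  refine cartan_ext b fun i hi => ?_
  have h := hφ.transform c c' p hp i hi
  rw [← root_cartanField_re D b φ c p i, ← root_cartanField_re D b φ c' p i,
    ← Complex.ofReal_exp, ← Complex.ofReal_exp, ← Complex.ofReal_pow, ← Complex.ofReal_mul,
    Complex.ofReal_inj] at h
  have hlog := congrArg Real.log h
  rw [Real.log_exp, Real.log_mul (pow_ne_zero _ (norm_ne_zero_iff.mpr hj)) (Real.exp_ne_zero _),
    Real.log_exp, Real.log_pow] at hlog
  have e : i.1 (cartanField D b φ c p + ((2 * Real.log ‖jac c c' p‖ : ℝ) : ℂ) • gradingElement b)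
      = i.1 (cartanField D b φ c p) + ((2 * Real.log ‖jac c c' p‖ : ℝ) : ℂ) := by
    simp [root_gradingElement b i hi]
  rw [e, ← root_cartanField_re D b φ c' p i, ← root_cartanField_re D b φ c p i, hlog]
  push_cast
  ring

theorem isHermitianMetric_todaMetric (hκ : IsCanonicalRoot U N κ) (hN0 : N ≠ 0)
    (hφ : IsTodaField D b U φ) :
    IsHermitianMetric U (todaBundle b π N κ) (todaMetric D b π φ) := by
  let _ : NormedAlgebra ℚ (V →L[ℂ] V) := NormedAlgebra.restrictScalars ℚ ℂ _
  have hsa : ∀ c p, IsSelfAdjoint (π.map (cartanField D b φ c p : 𝔤)) := fun c p =>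
    π.isSelfAdjoint (conj_cartanField D b φ c p)
  refine ⟨fun c => ?_, fun c p _ v w => ?_, fun c p _ v hv => ?_, fun c c' p hp v w => ?_⟩
  · simp only [todaMetric_eq]
    intro z hz
    have h1 : ContDiffWithinAt ℝ ∞
        (fun z => ∑ i, (φ c i (c.1.symm z) : ℂ) • π.map (D.h i.1.1 : 𝔤)) (coordDomain U c) z :=
      ContDiffWithinAt.sum fun i _ =>
        (Complex.ofRealCLM.contDiff.contDiffAt.comp_contDiffWithinAt z (hφ.smooth c i z hz)).smul
          contDiffWithinAt_const
    exact (NormedSpace.exp_analytic (𝕂 := ℝ) _).contDiffAt.comp_contDiffWithinAt z h1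
  · have h := (hsa c p).exp
    rw [ContinuousLinearMap.isSelfAdjoint_iff_isSymmetric] at h
    exact (h v w).symm
  · -- `e^B = e^{B/2} e^{B/2}` with self-adjoint invertible `e^{B/2}`
    let B : V →L[ℂ] V := ((1 / 2 : ℝ) : ℂ) • π.map (cartanField D b φ c p : 𝔤)
    have hhalf : IsSelfAdjoint ((1 / 2 : ℝ) : ℂ) := Complex.conj_ofReal _
    have hB : IsSelfAdjoint B := hhalf.smul (hsa c p)
    have e : todaMetric D b π φ c p = NormedSpace.exp B * NormedSpace.exp B := by
      rw [← NormedSpace.exp_add_of_commute (Commute.refl B), ← add_smul, todaMetric]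
      norm_num
    have hne : NormedSpace.exp B v ≠ 0 := by
      intro h0
      have h1 : (NormedSpace.exp (-B) * NormedSpace.exp B) v = v := by
        rw [← NormedSpace.exp_add_of_commute (Commute.refl B).neg_left]
        simp
      rw [mul_apply_eq_comp, h0, map_zero] at h1
      exact hv h1.symm
    have hs := ContinuousLinearMap.isSelfAdjoint_iff_isSymmetric.mp hB.exp v (NormedSpace.exp B v)
    rw [e, mul_apply_eq_comp]
    erw [← hs]
    have hpos : 0 < ‖NormedSpace.exp B v‖ ^ 2 := pow_pos (norm_pos_iff.mpr hne) 2
    rwa [← inner_self_eq_norm_sq (𝕜 := ℂ)] at hpos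
  · -- `g^* e^Φ g = e^{\bar t x + Φ + t x}` with `t = N log κ`
    have hx := π.isSelfAdjoint (D.conj_gradingElement b)
    have hk := hκ.ne_zero hN0 hp
    let S : V →L[ℂ] V := π.map (gradingElement b : 𝔤)
    let t : ℂ := N * Complex.log (κ c c' p)
    let B : V →L[ℂ] V := π.map (cartanField D b φ c p : 𝔤)
    have hSB : Commute S B := π.commute_cartan _ _
    have hg : ContinuousLinearMap.adjoint (todaBundle b π N κ c c' p)
        = NormedSpace.exp (starRingEnd ℂ t • S) := by
      rw [← ContinuousLinearMap.star_eq_adjoint, todaBundle, NormedSpace.star_exp, star_smul,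
        hx.star_eq]
      rfl
    have ht : ((2 * Real.log ‖jac c c' p‖ : ℝ) : ℂ) = starRingEnd ℂ t + t := by
      rw [add_comm, Complex.add_conj, ← hκ.pow_eq c c' p hp, norm_pow, Real.log_pow]
      simp [t, Complex.log_re]
    have e : todaMetric D b π φ c' p = ContinuousLinearMap.adjoint (todaBundle b π N κ c c' p) *
        (todaMetric D b π φ c p * todaBundle b π N κ c c' p) := by
      have e1 : π.map (cartanField D b φ c' p : 𝔤) = starRingEnd ℂ t • S + (B + t • S) := by
        rw [cartanField_transform D b hφ hp (hκ.jac_ne_zero hN0 hp), ht, AddMemClass.coe_add,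
          SetLike.val_smul, map_add, map_smul, add_smul]
        abel
      rw [hg, todaMetric, e1, NormedSpace.exp_add_of_commute, NormedSpace.exp_add_of_commute]
      · rfl
      · exact (hSB.smul_left t).symm
      · exact ((hSB.smul_left _).add_right (((Commute.refl S).smul_left _).smul_right _))
    rw [e, mul_apply_eq_comp, ContinuousLinearMap.adjoint_inner_right]
    rfl

end Metric

/-! ### Higgs fields and Hitchin's equation -/

section Higgs

variable {X : Type*} [TopologicalSpace X] [ChartedSpace ℂ X]
  {𝔤 : Type*} [LieRing 𝔤] [LieAlgebra ℂ 𝔤] [FiniteDimensional ℂ 𝔤] [LieAlgebra.IsKilling ℂ 𝔤]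
  {𝔥 : LieSubalgebra ℂ 𝔤} [𝔥.IsCartanSubalgebra]
  {ρ : CompactConjugation 𝔤} (D : WeylBasis 𝔥 ρ) (b : (LieAlgebra.IsKilling.rootSystem 𝔥).Base)
  {V : Type*} [NormedAddCommGroup V] [InnerProductSpace ℂ V] [CompleteSpace V] (π : UnitaryRep ρ V)
  {U : Set X} {N : ℕ} {κ : atlas ℂ X → atlas ℂ X → X → ℂ} {φ : atlas ℂ X → b.support → X → ℝ}

/-- A root vector for a weight of height `n` is a section of weight `n`: conjugation with
`k^{π(x)}` multiplies it by `k^n`. -/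
theorem todaBundle_mul_e (hκ : IsCanonicalRoot U N κ) (hN0 : N ≠ 0) {c c' : atlas ℂ X} {p : X}
    (hp : p ∈ U ∩ c.1.source ∩ c'.1.source) {α : LieModule.Weight ℂ 𝔥 𝔤} {n : ℤ}
    (hα : α (gradingElement b) = n) :
    todaBundle b π N κ c c' p * π.map (D.e α)
      = jac c c' p ^ n • (π.map (D.e α) * todaBundle b π N κ c c' p) := by
  rw [todaBundle, π.exp_mul_e D α (gradingElement b), hα, mul_comm _ (n : ℂ), Complex.exp_int_mul,
    Complex.exp_nat_mul, Complex.exp_log (hκ.ne_zero hN0 hp), hκ.pow_eq c c' p hp]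

theorem todaBundle_mul_ePlus (hκ : IsCanonicalRoot U N κ) (hN0 : N ≠ 0) {c c' : atlas ℂ X} {p : X}
    (hp : p ∈ U ∩ c.1.source ∩ c'.1.source) :
    todaBundle b π N κ c c' p * π.map (D.ePlus b)
      = jac c c' p • (π.map (D.ePlus b) * todaBundle b π N κ c c' p) := by
  rw [WeylBasis.ePlus, map_sum, Finset.mul_sum, Finset.sum_mul, Finset.smul_sum]
  refine Finset.sum_congr rfl fun i hi => ?_
  rw [todaBundle_mul_e D b π hκ hN0 hp (n := 1) (by rw [root_gradingElement b i hi, Int.cast_one]),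
    zpow_one]

theorem isHiggsField_todaHiggs (hκ : IsCanonicalRoot U N κ) (hN0 : N ≠ 0) :
    IsHiggsField U (todaBundle b π N κ) (todaHiggs D b π) where
  holomorphic _ := differentiableOn_const _
  transform _ _ _ hp := (todaBundle_mul_ePlus D b π hκ hN0 hp).symm

theorem isHiggsField_affineHiggs (hU : IsOpen U) (hκ : IsCanonicalRoot U N κ) (hN0 : N ≠ 0)
    (ψ : 𝔥.root) {u : atlas ℂ X → X → ℂ} (hu : IsSmoothSection U (b.height ψ + 1) u)
    (hu' : DbarClosed U u) :
    IsHiggsField U (todaBundle b π N κ) (affineHiggs D b π ψ u) where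
  holomorphic c := by
    have h : DifferentiableOn ℂ (fun z => u c (c.1.symm z)) (coordDomain U c) := by
      refine differentiableOn_complex_of_dzbar_eq_zero (isOpen_coordDomain hU c) (hu.smooth c) ?_
      intro z hz
      simpa [c.1.right_inv hz.1] using hu' c _ ⟨hz.2, c.1.map_target hz.1⟩
    simp only [affineHiggs, map_add, map_smul]
    exact (differentiableOn_const _).add (h.smul_const _)
  transform c c' p hp := by
    -- `u_{c'} k^{-ht ψ} = k u_c`, as `u` has weight `ht ψ + 1`
    have hj := hκ.jac_ne_zero hN0 hp
    have hψ : (-ψ.1 : LieModule.Weight ℂ 𝔥 𝔤) (gradingElement b) = ((-b.height ψ : ℤ) : ℂ) := by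
      rw [LieModule.Weight.coe_neg, Pi.neg_apply, root_gradingElement_eq_height, Int.cast_neg]
    simp only [affineHiggs, map_add, map_smul]
    rw [mul_add, add_mul, smul_add, todaBundle_mul_ePlus D b π hκ hN0 hp, mul_smul_comm,
      smul_mul_assoc, todaBundle_mul_e D b π hκ hN0 hp hψ, smul_smul, smul_smul,
      ← hu.transform c c' p hp, mul_right_comm, ← zpow_add₀ hj]
    simp

/-- The adjoint of `π(e_α)` with respect to the metric `e^Φ` is `e^{α(Φ)} π(e_{-α})`. -/
theorem metricAdjoint_todaMetric_e {α : LieModule.Weight ℂ 𝔥 𝔤} (hα : α.IsNonZero)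
    (c : atlas ℂ X) (p : X) :
    metricAdjoint (todaMetric D b π φ c p) (π.map (D.e α))
      = Complex.exp (α (cartanField D b φ c p)) • π.map (D.e (-α)) := by
  let _ : NormedAlgebra ℚ (V →L[ℂ] V) := NormedAlgebra.restrictScalars ℚ ℂ _
  have h := π.exp_mul_e D (-α) (cartanField D b φ c p) (-1)
  rw [neg_one_smul, LieModule.Weight.coe_neg, Pi.neg_apply, neg_one_mul, neg_neg] at h
  rw [metricAdjoint, π.adjoint_map, D.conj_e α hα, map_neg, neg_neg, todaMetric,
    Ring.inverse_exp, h, smul_mul_assoc, mul_assoc,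
    ← NormedSpace.exp_add_of_commute (Commute.refl _).neg_left, neg_add_cancel,
    NormedSpace.exp_zero, mul_one]

theorem metricAdjoint_add (h S T : V →L[ℂ] V) :
    metricAdjoint h (S + T) = metricAdjoint h S + metricAdjoint h T := by
  simp [metricAdjoint, mul_add, add_mul]

theorem metricAdjoint_smul (h T : V →L[ℂ] V) (a : ℂ) :
    metricAdjoint h (a • T) = starRingEnd ℂ a • metricAdjoint h T := by
  rw [metricAdjoint, LinearIsometryEquiv.map_smulₛₗ, mul_smul_comm, smul_mul_assoc]
  rfl

theorem metricAdjoint_todaMetric_ePlus (c : atlas ℂ X) (p : X) :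
    metricAdjoint (todaMetric D b π φ c p) (π.map (D.ePlus b))
      = π.map (∑ i ∈ b.support, Complex.exp (i.1 (cartanField D b φ c p)) • D.e (-i.1)) := by
  have h : ∀ s : Finset 𝔥.root, metricAdjoint (todaMetric D b π φ c p) (∑ i ∈ s, π.map (D.e i.1))
      = ∑ i ∈ s, metricAdjoint (todaMetric D b π φ c p) (π.map (D.e i.1)) := by
    intro s
    simp [metricAdjoint, Finset.mul_sum, Finset.sum_mul]
  rw [WeylBasis.ePlus, map_sum, h, map_sum]
  refine Finset.sum_congr rfl fun i _ => ?_
  rw [metricAdjoint_todaMetric_e D b π (LieSubalgebra.isNonZero_coe_root i), map_smul]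

theorem curvature_todaMetric (hU : IsOpen U) (hφ : IsTodaField D b U φ) {c : atlas ℂ X} {p : X}
    (hp : p ∈ U ∩ c.1.source) :
    curvature (chernForm fun z => todaMetric D b π φ c (c.1.symm z)) 0 (c.1 p)
      = -π.map (ddbarField D b φ c p : 𝔤) := by
  have hsm : ∀ i, ContDiffAt ℝ 2 (fun z => (φ c i (c.1.symm z) : ℂ)) (c.1 p) := fun i =>
    (Complex.ofRealCLM.contDiff.contDiffAt.comp _ ((hφ.smooth c i).contDiffAt
      ((isOpen_coordDomain hU c).mem_nhds (mem_coordDomain hp)))).of_le (by norm_cast)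
  simp only [todaMetric_eq]
  rw [curvature_chernForm_exp_sum (fun i : b.support => π.map (D.h i.1.1 : 𝔤))
    (fun i j => π.commute_cartan _ _) hsm, ddbarField, AddSubmonoidClass.coe_finsetSum, map_sum]
  simp only [SetLike.val_smul, map_smul, ddbar]

/-- Hitchin's equation for the Toda metric, reduced to a computation in `𝔤`: if the adjoint of
`π(y)` is `π(y')`, the equation is `∂∂̄Φ = [y, y']`. -/
theorem hitchinEquation_of_lie (hU : IsOpen U) (hφ : IsTodaField D b U φ)
    {θ : atlas ℂ X → X → V →L[ℂ] V} (h : ∀ c, ∀ p ∈ U ∩ c.1.source, ∃ y y' : 𝔤, θ c p = π.map y ∧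
      metricAdjoint (todaMetric D b π φ c p) (θ c p) = π.map y' ∧
      (ddbarField D b φ c p : 𝔤) = ⁅y, y'⁆) :
    HitchinEquation U (todaMetric D b π φ) θ := by
  intro c p hp
  obtain ⟨y, y', h1, h2, h3⟩ := h c p hp
  rw [curvature_todaMetric D b π hU hφ hp, h2, h1, h3, π.map_lie, neg_add_cancel]

theorem hitchinEquation_todaHiggs (hU : IsOpen U) (hφ : IsTodaField D b U φ)
    (heq : TodaEquation D b U φ) :
    HitchinEquation U (todaMetric D b π φ) (todaHiggs D b π) := by
  refine hitchinEquation_of_lie D b π hU hφ fun c p hp =>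
    ⟨_, _, rfl, metricAdjoint_todaMetric_ePlus D b π c p, ?_⟩
  rw [heq c p hp, D.lie_ePlus_sum b, AddSubmonoidClass.coe_finsetSum]
  rfl

theorem hitchinEquation_affineHiggs (hU : IsOpen U) (hφ : IsTodaField D b U φ) {ψ : 𝔥.root}
    (hψ : IsHighestRoot b ψ) {u : atlas ℂ X → X → ℂ} (heq : AffineTodaEquation D b U ψ φ u) :
    HitchinEquation U (todaMetric D b π φ) (affineHiggs D b π ψ u) := by
  refine hitchinEquation_of_lie D b π hU hφ fun c p hp =>
    ⟨_, (∑ i ∈ b.support, Complex.exp (i.1 (cartanField D b φ c p)) • D.e (-i.1))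
      + (starRingEnd ℂ (u c p) * Complex.exp (-ψ.1 (cartanField D b φ c p))) • D.e ψ.1, rfl, ?_, ?_⟩
  · have hψ0 := (LieSubalgebra.isNonZero_coe_root ψ).neg
    rw [affineHiggs, map_add, metricAdjoint_add, metricAdjoint_todaMetric_ePlus, map_smul,
      metricAdjoint_smul, metricAdjoint_todaMetric_e D b π hψ0, neg_neg, smul_smul, map_add,
      map_smul]
    rfl
  · -- the mixed brackets vanish, as `ψ + α_i` is no root
    have h1 : ⁅D.ePlus b, D.e ψ.1⁆ = 0 := by
      rw [WeylBasis.ePlus, sum_lie]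
      exact Finset.sum_eq_zero fun i hi => D.lie_simple_highest b hψ hi
    have h2 : ⁅D.e (-ψ.1), ∑ i ∈ b.support,
        Complex.exp (i.1 (cartanField D b φ c p)) • D.e (-i.1)⁆ = 0 := by
      rw [lie_sum]
      refine Finset.sum_eq_zero fun i hi => ?_
      rw [lie_smul, D.lie_neg_highest_neg_simple b hψ hi, smul_zero]
    have h3 : ⁅D.e (-ψ.1), D.e ψ.1⁆ = -(D.h ψ.1 : 𝔤) := by rw [D.coe_h, lie_skew]
    rw [heq.1 c p hp, add_lie, lie_add, lie_add, D.lie_ePlus_sum b, lie_smul, h1, smul_zero,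
      add_zero, smul_lie, h2, smul_zero, zero_add, smul_lie, lie_smul, h3, smul_smul, smul_neg,
      ← mul_assoc, Complex.mul_conj, Complex.normSq_eq_norm_sq, AddSubgroupClass.coe_sub,
      AddSubmonoidClass.coe_finsetSum, sub_eq_add_neg, Complex.ofReal_pow]
    rfl

end Higgs

/-! ### Local sections with prescribed norm -/

section LocalSection

variable {X : Type*} [TopologicalSpace X] [ChartedSpace ℂ X]

/-- A solution of `∂_z ∂_{z̄} f = 0` on a disc is the real part of a holomorphic function. -/
theorem exists_holomorphic_re_eq {f : ℂ → ℝ} {z₀ : ℂ} {r : ℝ}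
    (hf : ContDiffOn ℝ ∞ f (Metric.ball z₀ r))
    (h : ∀ z ∈ Metric.ball z₀ r, dz (dzbar fun y => (f y : ℂ)) z = 0) :
    ∃ F : ℂ → ℂ, DifferentiableOn ℂ F (Metric.ball z₀ r) ∧
      ∀ z ∈ Metric.ball z₀ r, (F z).re = f z := by
  have hat : ∀ z ∈ Metric.ball z₀ r, ContDiffAt ℝ 2 f z := fun z hz =>
    (hf.contDiffAt (Metric.isOpen_ball.mem_nhds hz)).of_le (by norm_cast)
  have hlap : ∀ z ∈ Metric.ball z₀ r, Laplacian.laplacian f z = 0 := by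
    intro z hz
    have h1 : ContDiffAt ℝ 2 (fun y => (f y : ℂ)) z :=
      Complex.ofRealCLM.contDiff.contDiffAt.comp z (hat z hz)
    have h2 := (hat z hz).laplacian_CLM_comp_left (l := Complex.ofRealCLM)
    rw [InnerProductSpace.laplacian_eq_iteratedFDeriv_complexPlane] at h2
    simp only [iteratedFDeriv_two_apply] at h2
    have h3 := h z hz
    rw [dz_dzbar_eq h1] at h3
    have h4 : Complex.ofRealCLM (Laplacian.laplacian f z) = 0 := by
      refine h2.symm.trans ?_
      rw [mul_eq_zero_iff_left (by norm_num)] at h3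
      exact h3
    simpa using h4
  have hharm : InnerProductSpace.HarmonicOnNhd f (Metric.ball z₀ r) := fun z hz =>
    ⟨hat z hz, Filter.eventuallyEq_of_mem (Metric.isOpen_ball.mem_nhds hz) hlap⟩
  obtain ⟨F, hF, hFf⟩ := hharm.exists_analyticOnNhd_ball_re_eq
  exact ⟨F, hF.differentiableOn, hFf⟩

theorem differentiableOn_coordChange [IsManifold (modelWithCornersSelf ℂ ℂ) ω X]
    (c c' : atlas ℂ X) :
    DifferentiableOn ℂ (fun z => c.1 (c'.1.symm z)) (coordDomain c.1.source c') := by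
  have h := (contDiffGroupoid ω (modelWithCornersSelf ℂ ℂ)).compatible c'.2 c.2
  rw [contDiffGroupoid, mem_groupoid_of_pregroupoid] at h
  have h1 : ContDiffOn ℂ ω _ _ := h.1
  refine (h1.differentiableOn (by simp)).mono ?_
  intro z hz
  simpa using! hz

variable {U : Set X} {N : ℕ} {κ : atlas ℂ X → atlas ℂ X → X → ℂ}

/-- Near each point the harmonic field `η` is the real part of a holomorphic `F`; then `e^F` is a
section with norm `e^η`. -/
theorem exists_section_norm_sq_eq [IsManifold (modelWithCornersSelf ℂ ℂ) ω X] (hU : IsOpen U)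
    (hκ : IsCanonicalRoot U N κ) (hN0 : N ≠ 0) {m : ℤ} {η : atlas ℂ X → X → ℝ}
    (hη : IsAffineField U m η) (hharm : ∀ c, ∀ p ∈ U ∩ c.1.source, ddbar (η c) c p = 0)
    {p : X} (hp : p ∈ U) :
    ∃ W : Set X, IsOpen W ∧ p ∈ W ∧ W ⊆ U ∧ ∃ u : atlas ℂ X → X → ℂ,
      IsSmoothSection W m u ∧ DbarClosed W u ∧
      ∀ c, ∀ q ∈ W ∩ c.1.source, ‖u c q‖ ^ 2 = Real.exp (2 * η c q) := by
  let c₀ : atlas ℂ X := ⟨chartAt ℂ p, chart_mem_atlas ℂ p⟩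
  have hp₀ : p ∈ c₀.1.source := mem_chart_source ℂ p
  obtain ⟨r, hr, hball⟩ := Metric.isOpen_iff.mp (isOpen_coordDomain hU c₀) (c₀.1 p)
    (mem_coordDomain ⟨hp, hp₀⟩)
  obtain ⟨F, hF, hFη⟩ := exists_holomorphic_re_eq ((hη.smooth c₀).mono hball) (by
    intro z hz
    have hz' := hball hz
    simpa [ddbar, c₀.1.right_inv hz'.1] using hharm c₀ _ ⟨hz'.2, c₀.1.map_target hz'.1⟩)
  let W : Set X := c₀.1.source ∩ c₀.1 ⁻¹' Metric.ball (c₀.1 p) r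
  have hWo : IsOpen W := c₀.1.isOpen_inter_preimage Metric.isOpen_ball
  have hWU : W ⊆ U := by
    intro q hq
    have := (hball hq.2).2
    rwa [Set.mem_preimage, c₀.1.left_inv hq.1] at this
  -- `e^F` in the chart `c₀`, carried to the chart `c` by the transformation law of `K^m`
  let u : atlas ℂ X → X → ℂ := fun c q => jac c₀ c q ^ m * Complex.exp (F (c₀.1 q))
  have hhol : ∀ c, DifferentiableOn ℂ (fun z => u c (c.1.symm z)) (coordDomain W c) := by
    intro c
    have h1 : DifferentiableOn ℂ (fun z => jac c₀ c (c.1.symm z) ^ m) (coordDomain W c) := by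
      refine ((hκ.holomorphic_zpow hN0 c₀ c (N * m)).mono ?_).congr fun z hz => ?_
      · exact fun z hz => ⟨hz.1, hWU hz.2, hz.2.1⟩
      · rw [← hκ.pow_eq c₀ c _ ⟨⟨hWU hz.2, hz.2.1⟩, c.1.map_target hz.1⟩, zpow_mul, zpow_natCast]
    have h2 : DifferentiableOn ℂ (fun z => F (c₀.1 (c.1.symm z))) (coordDomain W c) :=
      hF.comp ((differentiableOn_coordChange c₀ c).mono fun z hz => ⟨hz.1, hz.2.1⟩)
        fun z hz => hz.2.2
    exact h1.mul h2.cexp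
  refine ⟨W, hWo, ⟨hp₀, Metric.mem_ball_self hr⟩, hWU, u, ⟨fun c => ?_, fun c c' q hq => ?_⟩,
    fun c q hq => ?_, fun c q hq => ?_⟩
  · exact ((hhol c).contDiffOn (isOpen_coordDomain hWo c)).restrict_scalars ℝ
  · have hcoc := hκ.jac_mul_jac (c := c₀) (c' := c) (c'' := c') (p := q)
      ⟨⟨⟨hWU hq.1.1, hq.1.1.1⟩, hq.1.2⟩, hq.2⟩
    simp only [u]
    rw [← hcoc, mul_zpow]
    ring
  · exact dzbar_eq_zero_of_differentiableAt
      ((hhol c).differentiableAt ((isOpen_coordDomain hWo c).mem_nhds (mem_coordDomain hq)))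
  · have h1 := hη.transform c₀ c q ⟨⟨hWU hq.1, hq.1.1⟩, hq.2⟩
    have h2 : (F (c₀.1 q)).re = η c₀ q := by
      rw [hFη _ hq.1.2, c₀.1.left_inv hq.1.1]
    simp only [u]
    rw [h1, norm_mul, mul_pow, norm_zpow, Complex.norm_exp, h2, ← Real.exp_nat_mul, mul_comm 2 m,
      zpow_mul]
    norm_cast

end LocalSection

end TodaHiggs

open TodaHiggs in
theorem mainTheorem3
    {X : Type*} [TopologicalSpace X] [ChartedSpace ℂ X] [IsManifold (modelWithCornersSelf ℂ ℂ) ω X]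
    {𝔤 : Type*} [LieRing 𝔤] [LieAlgebra ℂ 𝔤] [FiniteDimensional ℂ 𝔤] [LieAlgebra.IsSimple ℂ 𝔤]
    (𝔥 : LieSubalgebra ℂ 𝔤) [𝔥.IsCartanSubalgebra]
    (b : (LieAlgebra.IsKilling.rootSystem 𝔥).Base)
    (ρ : CompactConjugation 𝔤) (D : WeylBasis 𝔥 ρ)
    {V : Type*} [NormedAddCommGroup V] [InnerProductSpace ℂ V] [FiniteDimensional ℂ V]
    [CompleteSpace V] (π : UnitaryRep ρ V)
    (U : Set X) (hU : IsOpen U)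
    (N : ℕ) (κ : atlas ℂ X → atlas ℂ X → X → ℂ) (hκ : IsCanonicalRoot U N κ)
    (hN : N = 2 ∨ (N = 1 ∧ ∀ a : ℂ,
      Module.End.HasEigenvalue (π.map (gradingElement b : 𝔤) : V →ₗ[ℂ] V) a → ∃ n : ℤ, a = n))
    (φ : atlas ℂ X → b.support → X → ℝ) (hφ : IsTodaField D b U φ) :
    (TodaEquation D b U φ →
      IsHitchinSolution U (todaBundle b π N κ) (todaMetric D b π φ) (todaHiggs D b π)) ∧
    (∀ ψ : 𝔥.root, IsHighestRoot b ψ →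
      (∀ u : atlas ℂ X → X → ℂ, IsSmoothSection U (b.height ψ + 1) u →
        AffineTodaEquation D b U ψ φ u →
        IsHitchinSolution U (todaBundle b π N κ) (todaMetric D b π φ) (affineHiggs D b π ψ u)) ∧
      (∀ η : atlas ℂ X → X → ℝ, IsAffineField U (b.height ψ + 1) η →
        ConformalAffineTodaEquation D b U ψ φ η →
        (∀ W : Set X, IsOpen W → W ⊆ U → ∀ u : atlas ℂ X → X → ℂ,
          IsSmoothSection W (b.height ψ + 1) u → DbarClosed W u →
          (∀ c, ∀ p ∈ W ∩ c.1.source, ‖u c p‖ ^ 2 = Real.exp (2 * η c p)) →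
          IsHitchinSolution W (todaBundle b π N κ) (todaMetric D b π φ)
            (affineHiggs D b π ψ u)) ∧
        (∀ p ∈ U, ∃ W : Set X, IsOpen W ∧ p ∈ W ∧ W ⊆ U ∧ ∃ u : atlas ℂ X → X → ℂ,
          IsSmoothSection W (b.height ψ + 1) u ∧ DbarClosed W u ∧
          (∀ c, ∀ q ∈ W ∩ c.1.source, ‖u c q‖ ^ 2 = Real.exp (2 * η c q)) ∧
          IsHitchinSolution W (todaBundle b π N κ) (todaMetric D b π φ)
            (affineHiggs D b π ψ u)))) := by
  have hN0 : N ≠ 0 := by omega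
  have hint : ∀ a : ℂ, Module.End.HasEigenvalue
      (π.map (gradingElement b : 𝔤) : V →ₗ[ℂ] V) a → ∃ n : ℤ, N * a = n := by
    intro a ha
    rcases hN with rfl | ⟨rfl, h⟩
    · exact_mod_cast π.exists_int_eigenvalue D b ha
    · simpa using h a ha
  have hbundle := fun (W : Set X) (h : W ⊆ U) =>
    isHolomorphicBundle_todaBundle b π (hκ.mono h) hN0 hint (D.conj_gradingElement b)
  have hmetric := fun (W : Set X) (h : W ⊆ U) =>
    isHermitianMetric_todaMetric D b π (hκ.mono h) hN0 (hφ.mono D b h)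
  have haffine : ∀ ψ : 𝔥.root, IsHighestRoot b ψ → ∀ W : Set X, IsOpen W → W ⊆ U →
      ∀ u : atlas ℂ X → X → ℂ, IsSmoothSection W (b.height ψ + 1) u →
      AffineTodaEquation D b W ψ φ u →
      IsHitchinSolution W (todaBundle b π N κ) (todaMetric D b π φ) (affineHiggs D b π ψ u) :=
    fun ψ hψ W hW h u hu heq =>
      ⟨hbundle W h, hmetric W h, isHiggsField_affineHiggs D b π hW (hκ.mono h) hN0 ψ hu heq.2,
        hitchinEquation_affineHiggs D b π hW (hφ.mono D b h) hψ heq⟩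
  refine ⟨fun heq => ⟨hbundle U subset_rfl, hmetric U subset_rfl,
    isHiggsField_todaHiggs D b π hκ hN0, hitchinEquation_todaHiggs D b π hU hφ heq⟩,
    fun ψ hψ => ⟨fun u hu heq => haffine ψ hψ U hU subset_rfl u hu heq, fun η hη heq => ?_⟩⟩
  have hconformal : ∀ W : Set X, IsOpen W → W ⊆ U → ∀ u : atlas ℂ X → X → ℂ,
      IsSmoothSection W (b.height ψ + 1) u → DbarClosed W u →
      (∀ c, ∀ p ∈ W ∩ c.1.source, ‖u c p‖ ^ 2 = Real.exp (2 * η c p)) →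
      IsHitchinSolution W (todaBundle b π N κ) (todaMetric D b π φ) (affineHiggs D b π ψ u) := by
    intro W hW h u hu hu' hnorm
    refine haffine ψ hψ W hW h u hu ⟨fun c p hp => ?_, hu'⟩
    have hexp : ((‖u c p‖ : ℂ)) ^ 2 = Complex.exp (2 * (η c p : ℂ)) := by
      exact_mod_cast congrArg (fun t : ℝ => (t : ℂ)) (hnorm c p hp)
    rw [heq.1 c p ⟨h hp.1, hp.2⟩, hexp, ← Complex.exp_add, ← sub_eq_add_neg]
  refine ⟨hconformal, fun p hp => ?_⟩
  obtain ⟨W, hW, hpW, h, u, hu, hu', hnorm⟩ := exists_section_norm_sq_eq hU hκ hN0 hη heq.2 hp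
  exact ⟨W, hW, hpW, h, u, hu, hu', hnorm, hconformal W hW h u hu hu' hnorm⟩
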